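/- Let $d\ge 3$ be fixed. Let $G^d(n,p)$ be the random $d$-uniform hypergraph on $n$ labelled vertices in which each $d$-element set of vertices is an edge with probability $p$, independently. For a finite $d$-uniform hypergraph $H$ write $|H|$ for its number of edges, $V(H)$ for its vertex set, and $\mathrm{aut}(H)$ for its number of automorphisms (bijections of $V(H)$ that preserve edges and non-edges). A \emph{unicycle} is a connected $d$-uniform hypergraph $U$ with $(d-1)|U|=|V(U)|$. The \emph{fragment} of a hypergraph is the union of those of its connected components that are unicycles. Let $\mathcal U$ be the class of finite $d$-uniform hypergraphs all of whose connected components are unicycles (including the empty hypergraph). For $0<c<(d-2)!$ set $$f(c)=\sum_{k\ge 2}\frac{1}{2k}\left(\frac{c}{(d-2)!}\right)^k=\frac12\ln\frac{1}{1-\frac{c}{(d-2)!}}-\frac{c}{2(d-2)!}.$$ \textbf{Theorem.} Let $0<c<(d-2)!$, let $p(n)\in[0,1]$ with $p(n)\sim c/n^{d-1}$ as $n\to\infty$, let $\mathrm{Frag}_n$ be the fragment of $G^d(n,p(n))$, and let $H\in\mathcal U$. Then $$\lim_{n\to\infty}\mathbf P\big(\mathrm{Frag}_n\simeq H\big)=e^{-f(c)}\,\frac{\left(c\,e^{-c/(d-2)!}\right)^{|H|}}{\mathrm{aut}(H)}.$$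 -/

import Mathlib

open Filter Asymptotics
open scoped Topology

namespace Hypergraph

/-- Every edge has exactly `d` vertices. -/
def IsUniform {α : Type*} (d : ℕ) (H : Hypergraph α) : Prop :=
  ∀ e ∈ E(H), e.ncard = d

/-- A hypergraph is connected if it has a vertex and any two vertices are joined by a chain of
vertices in which consecutive ones lie in a common edge. -/
def IsConnected {α : Type*} (H : Hypergraph α) : Prop :=
  V(H).Nonempty ∧ ∀ x ∈ V(H), ∀ y ∈ V(H), Relation.ReflTransGen H.Adj x y

/-- The connected component of the vertex `x`: the vertices reachable from `x`, and the edges that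
lie among them. -/
def component {α : Type*} (H : Hypergraph α) (x : α) : Hypergraph α where
  vertexSet := {y | y ∈ V(H) ∧ Relation.ReflTransGen H.Adj x y}
  edgeSet := {e | e ∈ E(H) ∧ e ⊆ {y | y ∈ V(H) ∧ Relation.ReflTransGen H.Adj x y}}
  subset_vertexSet_of_mem_edgeSet' := fun _ he => he.2

/-- The size `|H|`: the number of edges. -/
noncomputable def size {α : Type*} (H : Hypergraph α) : ℕ := E(H).ncard

/-- The excess `(d - 1) |H| - |V(H)|` of a `d`-uniform hypergraph. -/
noncomputable def excess {α : Type*} (d : ℕ) (H : Hypergraph α) : ℤ :=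
  ((d : ℤ) - 1) * (H.size : ℤ) - (V(H).ncard : ℤ)

/-- A unicycle is a finite connected `d`-uniform hypergraph of excess `0`. -/
def IsUnicycle {α : Type*} (d : ℕ) (H : Hypergraph α) : Prop :=
  V(H).Finite ∧ H.IsUniform d ∧ H.IsConnected ∧ H.excess d = 0

/-- The class of finite `d`-uniform hypergraphs all of whose connected components are unicycles
(the hypergraph without vertices is a member). -/
def HasUnicyclicComponents {α : Type*} (d : ℕ) (H : Hypergraph α) : Prop :=
  V(H).Finite ∧ H.IsUniform d ∧ ∀ x ∈ V(H), (H.component x).IsUnicycle d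

/-- The fragment of a hypergraph: the union of its connected components that are unicycles. -/
def fragment {α : Type*} (d : ℕ) (H : Hypergraph α) : Hypergraph α where
  vertexSet := {y | ∃ x ∈ V(H), (H.component x).IsUnicycle d ∧ y ∈ V(H.component x)}
  edgeSet := {e | ∃ x ∈ V(H), (H.component x).IsUnicycle d ∧ e ∈ E(H.component x)}
  subset_vertexSet_of_mem_edgeSet' := fun _ ⟨x, hx, hu, he⟩ _ hy => ⟨x, hx, hu, he.2 hy⟩

/-- A bijection between the vertex sets of `H` and `K` is an isomorphism if it maps edges to edges
and non-edges to non-edges. -/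
def IsIsomorphism {α β : Type*} (H : Hypergraph α) (K : Hypergraph β)
    (φ : V(H) ≃ V(K)) : Prop :=
  ∀ s : Set V(H), (Subtype.val '' s ∈ E(H) ↔ Subtype.val '' (φ '' s) ∈ E(K))

/-- `H` and `K` are isomorphic. -/
def IsIsomorphic {α β : Type*} (H : Hypergraph α) (K : Hypergraph β) : Prop :=
  ∃ φ : V(H) ≃ V(K), H.IsIsomorphism K φ

/-- The number of automorphisms. -/
noncomputable def aut {α : Type*} (H : Hypergraph α) : ℕ :=
  Nat.card {φ : V(H) ≃ V(H) // H.IsIsomorphism H φ}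

/-- The hypergraph with all elements of `α` as vertices and with edge set `S`. -/
def ofEdges {α : Type*} (S : Set (Set α)) : Hypergraph α where
  vertexSet := Set.univ
  edgeSet := S
  subset_vertexSet_of_mem_edgeSet' := fun e _ => Set.subset_univ e

/-- The law of the edge set of the random `d`-uniform hypergraph `G^d(n, p)` on `n` labelled
vertices: every set of `d` vertices is an edge with probability `p`, independently. -/
noncomputable def binomialRandomEdges (d n : ℕ) (p : unitInterval) :
    MeasureTheory.Measure (Set (Set (Fin n))) :=
  ProbabilityTheory.setBernoulli {e : Set (Fin n) | e.ncard = d} p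

/-- The probability that the fragment of `G^d(n, p)` is isomorphic to `H`. -/
noncomputable def probFragment {α : Type*} (d n : ℕ) (p : unitInterval) (H : Hypergraph α) : ℝ :=
  (binomialRandomEdges d n p).real {S | ((ofEdges S).fragment d).IsIsomorphic H}

/-- `f(c) = ∑_{k ≥ 2} (c / (d - 2)!) ^ k / (2 k)`. -/
noncomputable def cycleSum (d : ℕ) (c : ℝ) : ℝ :=
  ∑' k : ℕ, (c / ((d - 2).factorial : ℝ)) ^ (k + 2) / (2 * ((k : ℝ) + 2))

/-- The closed form of `f`; the series converges for `0 < c < (d - 2)!`. -/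
theorem hasSum_cycleSum (d : ℕ) (c : ℝ) (hc : 0 < c) (hcd : c < ((d - 2).factorial : ℝ)) :
    HasSum (fun k : ℕ => (c / ((d - 2).factorial : ℝ)) ^ (k + 2) / (2 * ((k : ℝ) + 2)))
      (1 / 2 * Real.log (1 / (1 - c / ((d - 2).factorial : ℝ)))
        - c / (2 * ((d - 2).factorial : ℝ))) := by
  have hF : (0 : ℝ) < ((d - 2).factorial : ℝ) := hc.trans hcd
  set x : ℝ := c / ((d - 2).factorial : ℝ) with hx
  have hx0 : 0 < x := div_pos hc hF
  have hx1 : x < 1 := (div_lt_one hF).2 hcd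
  have h := Real.hasSum_pow_div_log_of_abs_lt_one (x := x) (by rw [abs_lt]; constructor <;> linarith)
  rw [← hasSum_nat_add_iff' 1] at h
  have h2 := h.mul_left (1 / 2)
  have hval : 1 / 2 * Real.log (1 / (1 - x)) - c / (2 * ((d - 2).factorial : ℝ)) =
      1 / 2 * (-Real.log (1 - x) - ∑ i ∈ Finset.range 1, x ^ (i + 1) / ((i : ℝ) + 1)) := by
    rw [one_div (1 - x), Real.log_inv, hx]
    simp
    field_simp
  rw [hval]
  have hfun : (fun k : ℕ => x ^ (k + 2) / (2 * ((k : ℝ) + 2))) =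
      fun k : ℕ => 1 / 2 * (x ^ (k + 1 + 1) / (((k + 1 : ℕ) : ℝ) + 1)) := by
    funext k
    have hk : (k : ℝ) + 2 ≠ 0 := by positivity
    have hk' : (k : ℝ) + 1 + 1 = (k : ℝ) + 2 := by ring
    push_cast
    rw [hk']
    field_simp
  rw [hfun]
  exact h2

end Hypergraph

/-! Write `d = s + 2` and `x = c / s!`, and let `H` have `h` edges and hence `m = (s + 1) h`
vertices. The event that the fragment is a prescribed copy of `H` on a vertex set `W` splits into
two independent ones: the edges that meet `W` are exactly those of the copy, and the random
hypergraph on the other `n - m` vertices has no unicyclic component (`fragment_eq_iff`,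
`prob_fragment_eq`). Each copy is the image of `aut H` embeddings, so the probability in question is
`1 / aut H` times a sum over the `n (n - 1) ⋯ (n - m + 1) ∼ n ^ m` embeddings. The factor `n ^ m p ^
h` tends to `c ^ h`. About `h n ^ (s + 1) / s!` further edges have to be absent, which gives `exp
(-x) ^ h`. It remains to show that a unicyclic component is missing with probability tending to `exp
(-f)`, where `f = ∑ x ^ k / (2 k)` over `k ≥ 2` (`tendsto_uniProb_zero`).

Lower bound (`exp_le_uniProb_zero`): a component without closed walks is a tree, with one vertex
more than `d - 1` times its number of edges. So it suffices that no closed walk occurs. There are at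
most `(N * (N - 2).choose s) ^ k / (2 k)` edge sets of closed walks with `k` edges on `N` vertices,
and Harris' inequality bounds the probability of avoiding them all from below by a product, which is
at least `exp (-f)` up to a vanishing error.

Upper bound: let `P r` be the probability of exactly `r` unicyclic components. If a loose cycle is
added to a hypergraph with `r` of them, and its vertices are roots of a forest there, then exactly
one new unicyclic component arises; conversely a unicyclic component contains at most one loose
cycle. Double counting gives `(r + 1) P (r + 1) ≥ F * P r - o(1)` (`sum_le_uniProb_succ`), where `F`
is a partial sum of `f`; the error is small because short closed structures rarely touch a given
bounded set (`prob_lasso_le`). Hence `P r ≥ P 0 * F ^ r / r! - o(1)` for every fixed `r`. As the `P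
r` sum to at most `1`, `P 0` is asymptotically at most `exp (-F)`, and `F` can be taken close to
`f`. Neither moments nor an upper tail estimate are needed. -/

namespace RandomHypergraph

open Finset

/-! ### Finite product measures, correlation and double counting -/

section Prob

open Classical in
/-- The probability that a random subset of `Ω`, which contains each element independently with
probability `p`, satisfies `A`. -/
noncomputable def prob {ι : Type*} (Ω : Finset ι) (p : ℝ) (A : Finset ι → Prop) : ℝ :=
  ∑ S ∈ Ω.powerset with A S, p ^ #S * (1 - p) ^ (#Ω - #S)

variable {ι : Type*} {Ω : Finset ι} {p : ℝ} {A B : Finset ι → Prop}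

open Classical in
theorem prob_eq_sum_ite : prob Ω p A =
    ∑ S ∈ Ω.powerset, if A S then p ^ #S * (1 - p) ^ (#Ω - #S) else 0 := by
  rw [prob, Finset.sum_filter]

theorem weight_nonneg (hp0 : 0 ≤ p) (hp1 : p ≤ 1) (a b : ℕ) : 0 ≤ p ^ a * (1 - p) ^ b :=
  mul_nonneg (pow_nonneg hp0 _) (pow_nonneg (by linarith) _)

theorem prob_nonneg (hp0 : 0 ≤ p) (hp1 : p ≤ 1) : 0 ≤ prob Ω p A :=
  Finset.sum_nonneg fun _ _ => weight_nonneg hp0 hp1 _ _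

theorem prob_mono (hp0 : 0 ≤ p) (hp1 : p ≤ 1) (h : ∀ S ⊆ Ω, A S → B S) :
    prob Ω p A ≤ prob Ω p B := by
  classical
  refine Finset.sum_le_sum_of_subset_of_nonneg ?_ fun _ _ _ => weight_nonneg hp0 hp1 _ _
  intro S hS
  simp only [mem_filter, mem_powerset] at hS ⊢
  exact ⟨hS.1, h S hS.1 hS.2⟩

theorem prob_congr (h : ∀ S ⊆ Ω, (A S ↔ B S)) : prob Ω p A = prob Ω p B := by
  classical
  refine Finset.sum_congr (Finset.filter_congr fun S hS => h S (mem_powerset.1 hS)) fun _ _ => rfl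

theorem prob_true : prob Ω p (fun _ => True) = 1 := by
  classical
  have := Finset.prod_add (fun _ : ι => p) (fun _ => 1 - p) Ω
  simp only [prod_const, add_sub_cancel, one_pow] at this
  rw [prob_eq_sum_ite]
  refine Eq.trans ?_ this.symm
  refine Finset.sum_congr rfl fun S hS => ?_
  rw [if_pos trivial, card_sdiff_of_subset (mem_powerset.1 hS)]

theorem prob_le_one (hp0 : 0 ≤ p) (hp1 : p ≤ 1) : prob Ω p A ≤ 1 :=
  (prob_mono hp0 hp1 fun _ _ _ => trivial).trans_eq prob_true

theorem prob_not : prob Ω p (fun S => ¬ A S) = 1 - prob Ω p A := by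
  classical
  rw [eq_sub_iff_add_eq, add_comm, ← prob_true (Ω := Ω) (p := p)]
  simp only [prob_eq_sum_ite, ← Finset.sum_add_distrib]
  refine Finset.sum_congr rfl fun S _ => ?_
  by_cases h : A S <;> simp [h]

theorem prob_or_le (hp0 : 0 ≤ p) (hp1 : p ≤ 1) :
    prob Ω p (fun S => A S ∨ B S) ≤ prob Ω p A + prob Ω p B := by
  classical
  simp only [prob_eq_sum_ite, ← Finset.sum_add_distrib]
  refine Finset.sum_le_sum fun S _ => ?_
  have := weight_nonneg hp0 hp1 #S (#Ω - #S)
  by_cases h : A S <;> by_cases h' : B S <;> simp [h, h', this]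

theorem prob_exists_le {κ : Type*} (hp0 : 0 ≤ p) (hp1 : p ≤ 1) (I : Finset κ)
    (P : κ → Finset ι → Prop) :
    prob Ω p (fun S => ∃ i ∈ I, P i S) ≤ ∑ i ∈ I, prob Ω p (P i) := by
  classical
  simp only [prob_eq_sum_ite]
  rw [Finset.sum_comm]
  refine Finset.sum_le_sum fun S _ => ?_
  have hw := weight_nonneg hp0 hp1 #S (#Ω - #S)
  split_ifs with h
  · obtain ⟨i, hi, hS⟩ := h
    refine le_trans ?_ (Finset.single_le_sum (f := fun i => if P i S then
      p ^ #S * (1 - p) ^ (#Ω - #S) else 0) (fun j _ => ?_) hi)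
    · simp [hS]
    · split_ifs <;> simp [hw]
  · refine Finset.sum_nonneg fun j _ => ?_
    split_ifs <;> simp [hw]

/-- A sum of probabilities of events is bounded by the largest number of events that hold at the
same time, times the probability that one holds. -/
theorem sum_prob_le {κ : Type*} (hp0 : 0 ≤ p) (hp1 : p ≤ 1) (I : Finset κ)
    (P : κ → Finset ι → Prop) (m : ℕ) (hA : ∀ S ⊆ Ω, ∀ i ∈ I, P i S → A S)
    (h : ∀ S ⊆ Ω, A S → ∀ J ⊆ I, (∀ i ∈ J, P i S) → #J ≤ m) :
    ∑ i ∈ I, prob Ω p (P i) ≤ m * prob Ω p A := by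
  classical
  simp only [prob_eq_sum_ite]
  rw [Finset.sum_comm, Finset.mul_sum]
  refine Finset.sum_le_sum fun S hS => ?_
  have hw := weight_nonneg hp0 hp1 #S (#Ω - #S)
  rw [mem_powerset] at hS
  rw [← Finset.sum_filter, Finset.sum_const, nsmul_eq_mul]
  split_ifs with hAS
  · gcongr
    exact h S hS hAS _ (filter_subset _ _) fun i hi => (mem_filter.1 hi).2
  · rw [Finset.filter_false_of_mem fun i hi hP => hAS (hA S hS i hi hP)]
    simp

/-- Independence of the two parts of a random set. -/
theorem prob_inter_eq_and [DecidableEq ι] {Ω₁ Ω₂ F : Finset ι} (hd : Disjoint Ω₁ Ω₂)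
    (hF : F ⊆ Ω₁) :
    prob (Ω₁ ∪ Ω₂) p (fun S => S ∩ Ω₁ = F ∧ A (S ∩ Ω₂)) =
      p ^ #F * (1 - p) ^ (#Ω₁ - #F) * prob Ω₂ p A := by
  classical
  rw [prob, prob, Finset.mul_sum]
  have hd' := Finset.disjoint_left.1 hd
  refine (Finset.sum_bij' (fun T _ => F ∪ T) (fun S _ => S ∩ Ω₂) ?_ ?_ ?_ ?_ ?_).symm
  · intro T hT
    simp only [mem_filter, mem_powerset] at hT ⊢
    have h1 : (F ∪ T) ∩ Ω₂ = T := by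
      ext x
      have := @hT.1 x
      have := @hF x
      have := @hd' x
      simp only [mem_inter, mem_union]
      tauto
    refine ⟨Finset.union_subset_union hF hT.1, ?_, by rw [h1]; exact hT.2⟩
    ext x
    have := @hT.1 x
    have := @hF x
    have := @hd' x
    simp only [mem_inter, mem_union]
    tauto
  · intro S hS
    simp only [mem_filter, mem_powerset] at hS ⊢
    exact ⟨inter_subset_right, hS.2.2⟩
  · intro T hT
    simp only [mem_filter, mem_powerset] at hT ⊢
    ext x
    have := @hT.1 x
    have := @hF x
    have := @hd' x
    simp only [mem_inter, mem_union]
    tauto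
  · intro S hS
    simp only [mem_filter, mem_powerset] at hS ⊢
    rw [← hS.2.1, ← Finset.inter_union_distrib_left]
    exact inter_eq_left.2 hS.1
  · intro T hT
    simp only [mem_filter, mem_powerset] at hT
    have h1 : #(F ∪ T) = #F + #T :=
      Finset.card_union_of_disjoint (hd.mono hF hT.1)
    have h2 : #(Ω₁ ∪ Ω₂) - #(F ∪ T) = (#Ω₁ - #F) + (#Ω₂ - #T) := by
      have := Finset.card_union_of_disjoint hd
      have := card_le_card hF
      have := card_le_card hT.1
      omega
    rw [h2, h1]
    ring

theorem prob_superset [DecidableEq ι] {C : Finset ι} (hC : C ⊆ Ω) :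
    prob Ω p (fun S => C ⊆ S) = p ^ #C := by
  have h := prob_inter_eq_and (p := p) (A := fun _ => True) (disjoint_sdiff (s := C) (t := Ω))
    (Subset.refl C)
  rw [Finset.union_sdiff_of_subset hC, prob_true] at h
  simpa [Finset.inter_eq_right] using h

/-- The elements of `C` are independent of the others, so the two sides are `p ^ #C * (1 - p) ^ #C *
Q` and `p ^ #C * Q`, with `Q` the probability of `A` on `Ω \ C`. This allows a cycle to be planted
in a random hypergraph. -/
theorem prob_superset_and_sdiff [DecidableEq ι] (hp0 : 0 ≤ p) (hp1 : p ≤ 1) {C : Finset ι}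
    (hC : C ⊆ Ω) :
    p ^ #C * prob Ω p (fun S => A S ∧ Disjoint S C) ≤
      prob Ω p (fun S => C ⊆ S ∧ A (S \ C)) := by
  have h := prob_inter_eq_and (p := p) (A := A) (disjoint_sdiff (s := C) (t := Ω))
    (Subset.refl C)
  have h' := prob_inter_eq_and (p := p) (A := A) (disjoint_sdiff (s := C) (t := Ω))
    (empty_subset C)
  rw [Finset.union_sdiff_of_subset hC] at h h'
  have e1 : prob Ω p (fun S => C ⊆ S ∧ A (S \ C)) = p ^ #C * prob (Ω \ C) p A := by
    rw [Nat.sub_self, pow_zero, mul_one] at h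
    rw [← h]
    refine prob_congr fun S hS => ?_
    rw [Finset.inter_eq_right, ← Finset.inter_sdiff_assoc, Finset.inter_eq_left.2 hS]
  have e2 : prob Ω p (fun S => A S ∧ Disjoint S C) = (1 - p) ^ #C * prob (Ω \ C) p A := by
    rw [card_empty, pow_zero, one_mul, Nat.sub_zero] at h'
    rw [← h']
    refine prob_congr fun S hS => ?_
    rw [← Finset.inter_sdiff_assoc, Finset.inter_eq_left.2 hS, ← disjoint_iff_inter_eq_empty,
      and_comm]
    refine and_congr_right fun hd => ?_
    rw [Finset.sdiff_eq_self_of_disjoint hd]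
  rw [e1, e2]
  refine mul_le_mul_of_nonneg_left ?_ (pow_nonneg hp0 _)
  exact mul_le_of_le_one_left (prob_nonneg hp0 hp1) (pow_le_one₀ (by linarith) (by linarith))

/-- Increasing events are positively correlated. -/
theorem prob_mul_le_prob_and [Fintype ι] (hp0 : 0 ≤ p) (hp1 : p ≤ 1)
    (hA : Monotone A) (hB : Monotone B) :
    prob Ω p A * prob Ω p B ≤ prob Ω p (fun S => A S ∧ B S) := by
  classical
  have key : ∀ P : Finset ι → Prop, prob Ω p P =
      ∑ S, (if S ⊆ Ω then p ^ #S * (1 - p) ^ (#Ω - #S) else 0) * (if P S then 1 else 0) := by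
    intro P
    rw [prob, Finset.sum_filter, ← Finset.sum_subset (Finset.subset_univ Ω.powerset)]
    · refine Finset.sum_congr rfl fun S hS => ?_
      rw [mem_powerset] at hS
      simp [hS]
    · intro S _ hS
      rw [mem_powerset] at hS
      simp [hS]
  have hone : ∑ S, (if S ⊆ Ω then p ^ #S * (1 - p) ^ (#Ω - #S) else 0) = 1 := by
    have := key fun _ => True
    rw [prob_true] at this
    simpa using this.symm
  have hmono : ∀ P : Finset ι → Prop, Monotone P →
      Monotone fun S => if P S then (1 : ℝ) else 0 := by
    intro P hP S T hST
    have := hP hST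
    beta_reduce
    split_ifs with h1 h2
    · exact le_rfl
    · exact absurd (this h1) h2
    · exact zero_le_one
    · exact le_rfl
  -- The weight is supported on the subsets of `Ω`. There `#(S ∩ T) + #(S ∪ T) = #S + #T` turns the
  -- lattice condition into an equality; otherwise its left side vanishes.
  have h := fkg (μ := fun S => if S ⊆ Ω then p ^ #S * (1 - p) ^ (#Ω - #S) else 0)
    (f := fun S => if A S then (1 : ℝ) else 0) (g := fun S => if B S then (1 : ℝ) else 0)
    (fun S => by
      dsimp only [Pi.zero_apply]
      split_ifs
      exacts [weight_nonneg hp0 hp1 _ _, le_rfl])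
    (fun S => by dsimp only [Pi.zero_apply]; split_ifs <;> norm_num)
    (fun S => by dsimp only [Pi.zero_apply]; split_ifs <;> norm_num)
    (hmono A hA) (hmono B hB)
    (fun S T => by
      by_cases hS : S ⊆ Ω
      · by_cases hT : T ⊆ Ω
        · have h1 : S ⊓ T ⊆ Ω := inter_subset_left.trans hS
          have h2 : S ⊔ T ⊆ Ω := union_subset hS hT
          have h3 : #(S ⊓ T) + #(S ⊔ T) = #S + #T := Finset.card_inter_add_card_union S T
          have h4 := card_le_card hS
          have h5 := card_le_card hT
          have h6 := card_le_card h1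
          have h7 := card_le_card h2
          have h8 : (#Ω - #(S ⊓ T)) + (#Ω - #(S ⊔ T)) = (#Ω - #S) + (#Ω - #T) := by omega
          rw [if_pos hS, if_pos hT, if_pos h1, if_pos h2, mul_mul_mul_comm, ← pow_add, ← pow_add,
            mul_mul_mul_comm, ← pow_add, ← pow_add, h3, h8]
        · rw [if_neg hT, mul_zero]
          split_ifs <;> simp [weight_nonneg hp0 hp1, mul_nonneg]
      · rw [if_neg hS, zero_mul]
        split_ifs <;> simp [weight_nonneg hp0 hp1, mul_nonneg])
  rw [hone, one_mul, ← key, ← key] at h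
  refine h.trans_eq ?_
  rw [key]
  refine Finset.sum_congr rfl fun S _ => ?_
  by_cases h1 : A S <;> by_cases h2 : B S <;> simp [h1, h2]

/-- Harris' lower bound for the probability that a random set contains no member of a family. -/
theorem prod_le_prob_forall_not_subset [Fintype ι] (hp0 : 0 ≤ p) (hp1 : p ≤ 1)
    (𝓑 : Finset (Finset ι)) (h𝓑 : ∀ C ∈ 𝓑, C ⊆ Ω) :
    ∏ C ∈ 𝓑, (1 - p ^ #C) ≤ prob Ω p (fun S => ∀ C ∈ 𝓑, ¬ C ⊆ S) := by
  classical
  induction 𝓑 using Finset.induction_on with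
  | empty => simp [prob_true]
  | insert C 𝓑 hC ih =>
    have ih' := ih fun D hD => h𝓑 D (mem_insert_of_mem hD)
    have hCΩ := h𝓑 C (mem_insert_self _ _)
    rw [Finset.prod_insert hC]
    have hcor := prob_mul_le_prob_and (Ω := Ω) (A := fun S => C ⊆ S)
      (B := fun S => ∃ D ∈ 𝓑, D ⊆ S) hp0 hp1 (fun S T hST h => h.trans hST)
      (fun S T hST ⟨D, hD, h⟩ => ⟨D, hD, h.trans hST⟩)
    have e1 : prob Ω p (fun S => ∀ D ∈ 𝓑, ¬ D ⊆ S) = 1 - prob Ω p (fun S => ∃ D ∈ 𝓑, D ⊆ S) := by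
      rw [← prob_not]
      exact prob_congr fun S _ => by push Not; rfl
    have e2 : prob Ω p (fun S => ∀ D ∈ insert C 𝓑, ¬ D ⊆ S) =
        1 - prob Ω p (fun S => C ⊆ S ∨ ∃ D ∈ 𝓑, D ⊆ S) := by
      rw [← prob_not]
      exact prob_congr fun S _ => by simp
    have e3 : prob Ω p (fun S => C ⊆ S ∨ ∃ D ∈ 𝓑, D ⊆ S) =
        prob Ω p (fun S => C ⊆ S) + prob Ω p (fun S => ∃ D ∈ 𝓑, D ⊆ S) -
          prob Ω p (fun S => C ⊆ S ∧ ∃ D ∈ 𝓑, D ⊆ S) := by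
      rw [eq_sub_iff_add_eq]
      simp only [prob_eq_sum_ite, ← Finset.sum_add_distrib]
      refine Finset.sum_congr rfl fun S _ => ?_
      by_cases h1 : C ⊆ S <;> by_cases h2 : ∃ D ∈ 𝓑, D ⊆ S <;> simp only [h1, h2] <;> simp
    have hpC : p ^ #C ≤ 1 := pow_le_one₀ hp0 hp1
    rw [prob_superset hCΩ] at hcor e3
    rw [e2, e3]
    have := mul_le_mul_of_nonneg_left ih' (sub_nonneg.2 hpC)
    rw [e1] at this
    -- With `A`, `B` the two increasing events, `1 - P(A ∨ B) = 1 - P(A) - P(B) + P(A ∧ B)`, which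
    -- is at least `(1 - P(A)) (1 - P(B))` by positive correlation.
    nlinarith

end Prob

/-! ### Exploration of components and rooted forests -/

section Components

theorem card_union_edge_le {V : Type*} [DecidableEq V] {X e : Finset V} {d : ℕ} {v : V} (hd : #e = d) (hv : v ∈ e) (hX : v ∈ X) :
    #(X ∪ e) ≤ #X + (d - 1) := by
  have h1 := card_union_add_card_inter X e
  have h2 : 0 < #(X ∩ e) := card_pos.2 ⟨v, mem_inter.2 ⟨hX, hv⟩⟩
  omega

variable {V : Type*}

/-- Two vertices are linked if a common edge contains them. -/
def Linked (S : Finset (Finset V)) (x y : V) : Prop := ∃ e ∈ S, x ∈ e ∧ y ∈ e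

theorem Linked.symm {S : Finset (Finset V)} {x y : V} (h : Linked S x y) : Linked S y x := by
  obtain ⟨e, he, hx, hy⟩ := h
  exact ⟨e, he, hy, hx⟩

variable [Fintype V]

open Classical in
/-- The vertices that can be reached from a vertex in `X` along edges in `S`. -/
noncomputable def reach (X : Finset V) (S : Finset (Finset V)) : Finset V :=
  {y | ∃ x ∈ X, Relation.ReflTransGen (Linked S) x y}

open Classical in
/-- The edges in `S` that can be reached from a vertex in `X`. -/
noncomputable def inner (X : Finset V) (S : Finset (Finset V)) : Finset (Finset V) :=
  {e ∈ S | e ⊆ reach X S}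

variable {X Y : Finset V} {S T : Finset (Finset V)} {d : ℕ} {x y v : V} {e : Finset V}

theorem mem_reach : y ∈ reach X S ↔ ∃ x ∈ X, Relation.ReflTransGen (Linked S) x y := by
  simp [reach]

theorem mem_reach_singleton : y ∈ reach {x} S ↔ Relation.ReflTransGen (Linked S) x y := by
  simp [reach]

theorem mem_inner : e ∈ inner X S ↔ e ∈ S ∧ e ⊆ reach X S := by
  simp [inner]

theorem subset_reach : X ⊆ reach X S := fun x hx => mem_reach.2 ⟨x, hx, .refl⟩

theorem edge_subset_reach (he : e ∈ S) (hv : v ∈ e) (h : v ∈ reach X S) : e ⊆ reach X S := by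
  intro y hy
  obtain ⟨x, hx, hxv⟩ := mem_reach.1 h
  exact mem_reach.2 ⟨x, hx, hxv.tail ⟨e, he, hv, hy⟩⟩

theorem mem_inner_of_mem (he : e ∈ S) (hv : v ∈ e) (h : v ∈ reach X S) : e ∈ inner X S :=
  mem_inner.2 ⟨he, edge_subset_reach he hv h⟩

theorem reach_subset (hX : X ⊆ Y) (h : ∀ e ∈ S, ∀ v ∈ e, v ∈ Y → e ⊆ Y) : reach X S ⊆ Y := by
  intro y hy
  obtain ⟨x, hx, hxy⟩ := mem_reach.1 hy
  induction hxy with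
  | refl => exact hX hx
  | tail _ hbc ih =>
    obtain ⟨e, he, hb, hc⟩ := hbc
    exact h e he _ hb (ih (mem_reach.2 ⟨x, hx, by assumption⟩)) hc

theorem reach_mono (hX : X ⊆ Y) (hS : S ⊆ T) : reach X S ⊆ reach Y T :=
  reach_subset (hX.trans subset_reach) fun _ he _ hv h => edge_subset_reach (hS he) hv h

theorem mem_reach_comm : y ∈ reach {x} S ↔ x ∈ reach {y} S := by
  rw [mem_reach_singleton, mem_reach_singleton]
  have : Std.Symm (Linked S) := ⟨fun _ _ h => h.symm⟩
  exact ⟨fun h => Std.Symm.symm _ _ h, fun h => Std.Symm.symm _ _ h⟩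

theorem reach_eq_of_mem (h : y ∈ reach {x} S) : reach {y} S = reach {x} S := by
  have key : ∀ {x y : V}, y ∈ reach {x} S → reach {y} S ⊆ reach {x} S := fun h =>
    reach_subset (singleton_subset_iff.2 h) fun _ he _ hv h => edge_subset_reach he hv h
  exact (key h).antisymm (key (mem_reach_comm.1 h))

theorem inner_eq_of_mem (h : y ∈ reach {x} S) : inner {y} S = inner {x} S := by
  rw [inner, reach_eq_of_mem h, inner]

/-- If no edge meets `X`, nothing else is reached. -/
theorem reach_eq_self (h : ∀ e ∈ S, ∀ v ∈ e, v ∉ X) : reach X S = X :=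
  (reach_subset Subset.rfl fun e he v hv hX => absurd hX (h e he v hv)).antisymm subset_reach

theorem inner_eq_empty (hS : ∀ e ∈ S, e.Nonempty) (h : ∀ e ∈ S, ∀ v ∈ e, v ∉ X) :
    inner X S = ∅ := by
  refine Finset.eq_empty_of_forall_notMem fun e he => ?_
  rw [mem_inner, reach_eq_self h] at he
  obtain ⟨v, hv⟩ := hS e he.1
  exact h e he.1 v hv (he.2 hv)

variable [DecidableEq V]

/-- One step of the exploration: an edge that meets the root set is deleted and its vertices become
roots. The inductions on the number of edges below all use this step. -/
theorem reach_erase (he : e ∈ S) (hv : v ∈ e) (hX : v ∈ X) :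
    reach (X ∪ e) (S.erase e) = reach X S := by
  apply Subset.antisymm
  · refine reach_subset (union_subset subset_reach
      (edge_subset_reach he hv (subset_reach hX))) fun f hf u hu h =>
        edge_subset_reach (mem_of_mem_erase hf) hu h
  · refine reach_subset (subset_union_left.trans subset_reach) fun f hf u hu h => ?_
    by_cases hfe : f = e
    · subst hfe
      exact subset_union_right.trans subset_reach
    · exact edge_subset_reach (mem_erase.2 ⟨hfe, hf⟩) hu h

theorem inner_erase (he : e ∈ S) (hv : v ∈ e) (hX : v ∈ X) :
    inner (X ∪ e) (S.erase e) = (inner X S).erase e := by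
  ext f
  rw [mem_inner, reach_erase he hv hX, mem_erase, mem_erase, mem_inner, and_assoc]

theorem card_inner_erase (he : e ∈ S) (hv : v ∈ e) (hX : v ∈ X) :
    #(inner X S) = #(inner (X ∪ e) (S.erase e)) + 1 := by
  rw [inner_erase he hv hX, card_erase_add_one]
  exact mem_inner_of_mem he hv (subset_reach hX)

/-- Each explored edge already shares a vertex with the current root set, so it contributes at most
`d - 1` new vertices. Equality characterizes forests rooted at `X`. -/
theorem card_reach_le (X : Finset V) (S : Finset (Finset V))
    (hS : ∀ e ∈ S, #e = d) : #(reach X S) ≤ #X + (d - 1) * #(inner X S) := by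
  induction hn : #S generalizing X S with
  | zero =>
    rw [card_eq_zero] at hn
    subst hn
    rw [reach_eq_self (by simp)]
    omega
  | succ n ih =>
    by_cases h : ∃ e ∈ S, ∃ v ∈ e, v ∈ X
    · obtain ⟨e, he, v, hv, hX⟩ := h
      have h1 := ih (X ∪ e) (S.erase e) (fun f hf => hS f (mem_of_mem_erase hf))
        (by rw [card_erase_of_mem he]; omega)
      rw [reach_erase he hv hX] at h1
      rw [card_inner_erase he hv hX]
      have h2 := card_union_edge_le (hS e he) hv hX
      rw [mul_add, mul_one]
      omega
    · push Not at h
      rw [reach_eq_self h]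
      omega

/-- In a forest rooted at `X`, every nonempty set of edges has a member that meets `X` and the
other members in at most one vertex. -/
theorem exists_card_inter_le_one (hd : 1 ≤ d) (X : Finset V) (S : Finset (Finset V))
    (hS : ∀ e ∈ S, #e = d) (h : #(reach X S) = #X + (d - 1) * #(inner X S))
    (hT : T ⊆ inner X S) (hT0 : T.Nonempty) :
    ∃ e ∈ T, #(e ∩ (X ∪ (T.erase e).biUnion id)) ≤ 1 := by
  induction hn : #S generalizing X S T with
  | zero =>
    rw [card_eq_zero] at hn
    subst hn
    obtain ⟨e, he⟩ := hT0
    simpa [inner] using hT he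
  | succ n ih =>
    by_cases h' : ∃ e ∈ S, ∃ v ∈ e, v ∈ X
    · obtain ⟨e, he, v, hv, hX⟩ := h'
      have hS' : ∀ f ∈ S.erase e, #f = d := fun f hf => hS f (mem_of_mem_erase hf)
      -- The bounds `h1` and `h2` add up to the equality `h`, so both are tight: `e` meets `X` in a
      -- single vertex, and the remaining edges form a forest rooted at `X ∪ e`.
      have h1 := card_reach_le (X ∪ e) (S.erase e) hS'
      have h2 := card_union_edge_le (hS e he) hv hX
      have h3 := card_union_add_card_inter X e
      have h4 := hS e he
      rw [reach_erase he hv hX] at h1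
      rw [card_inner_erase he hv hX, mul_add, mul_one] at h
      by_cases hTe : T.erase e = ∅
      · obtain ⟨f, hf⟩ := hT0
        have hfe : f = e := by
          by_contra hne
          simpa [hTe] using mem_erase.2 ⟨hne, hf⟩
        subst hfe
        refine ⟨f, hf, ?_⟩
        rw [hTe, biUnion_empty, union_empty, inter_comm]
        omega
      · obtain ⟨f, hf, hf1⟩ := ih (T := T.erase e) (X ∪ e) (S.erase e) hS'
          (by rw [reach_erase he hv hX]; omega)
          (by rw [inner_erase he hv hX]; exact erase_subset_erase e hT)
          (nonempty_iff_ne_empty.2 hTe) (by rw [card_erase_of_mem he]; omega)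
        refine ⟨f, mem_of_mem_erase hf, (card_le_card (inter_subset_inter_left ?_)).trans hf1⟩
        intro u hu
        simp only [mem_union, mem_biUnion, mem_erase, id] at hu ⊢
        rcases hu with hu | ⟨g, ⟨hgf, hg⟩, hu⟩
        · exact Or.inl (Or.inl hu)
        · by_cases hge : g = e
          · subst hge
            exact Or.inl (Or.inr hu)
          · exact Or.inr ⟨g, ⟨hgf, hge, hg⟩, hu⟩
    · push Not at h'
      rw [inner_eq_empty (fun e he => card_pos.1 (by rw [hS e he]; omega)) h'] at hT
      obtain ⟨e, he⟩ := hT0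
      simpa using hT he

end Components

/-! ### Lassos and closed walks as obstructions to being a forest -/

section Lasso

variable {V : Type*}

/-- `Trail S X l v`: a walk along edges in `S` from a vertex in `X` to `v`; the list `l` holds its
edges, the last one first, and consecutive vertices are distinct. -/
inductive Trail (S : Finset (Finset V)) (X : Finset V) : List (Finset V) → V → Prop
  | nil {v : V} : v ∈ X → Trail S X [] v
  | cons {l : List (Finset V)} {v u : V} {e : Finset V} :
      Trail S X l v → e ∈ S → v ∈ e → u ∈ e → u ≠ v → Trail S X (e :: l) u

/-- A walk from `X` without repeated edges whose last edge meets `X` or an earlier edge in a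
second vertex. -/
def Lasso (S : Finset (Finset V)) (X : Finset V) : Prop :=
  ∃ l v e w, Trail S X l v ∧ (e :: l).Nodup ∧ e ∈ S ∧ v ∈ e ∧ w ∈ e ∧ w ≠ v ∧
    (w ∈ X ∨ ∃ f ∈ l, w ∈ f)

variable {S : Finset (Finset V)} {X Y : Finset V} {l : List (Finset V)} {v w : V}
  {e : Finset V}

theorem Trail.mono {T : Finset (Finset V)} (h : Trail S X l v) (hS : S ⊆ T) (hX : X ⊆ Y) :
    Trail T Y l v := by
  induction h with
  | nil h => exact .nil (hX h)
  | cons _ he h1 h2 h3 ih => exact .cons ih (hS he) h1 h2 h3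

theorem Lasso.mono {T : Finset (Finset V)} (h : Lasso S X) (hS : S ⊆ T) (hX : X ⊆ Y) :
    Lasso T Y := by
  obtain ⟨l, v, e, w, h1, h2, h3, h4, h5, h6, h7⟩ := h
  exact ⟨l, v, e, w, h1.mono hS hX, h2, hS h3, h4, h5, h6, h7.imp_left fun h => hX h⟩

theorem Trail.mem_of_mem (h : Trail S X l v) : ∀ f ∈ l, f ∈ S := by
  induction h with
  | nil _ => simp
  | cons _ he _ _ _ ih => simpa [he] using ih

/-- A walk that starts at a new root in `e` can be preceded by the step from `v` through `e`. Lists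
run backwards, so this first edge is appended at the end. -/
theorem Trail.of_erase [DecidableEq V] {u : V} (he : e ∈ S) (hv : v ∈ e) (hX : v ∈ X)
    (h : Trail (S.erase e) (X ∪ e) l u) : Trail S X l u ∨ Trail S X (l ++ [e]) u := by
  induction h with
  | @nil u h =>
    by_cases hu : u ∈ X
    · exact Or.inl (.nil hu)
    · refine Or.inr (.cons (.nil hX) he hv ?_ ?_)
      · simpa [hu] using h
      · rintro rfl
        exact hu hX
  | cons _ hf h1 h2 h3 ih =>
    exact ih.imp (fun h => .cons h (mem_of_mem_erase hf) h1 h2 h3)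
      (fun h => .cons h (mem_of_mem_erase hf) h1 h2 h3)

theorem Lasso.of_erase [DecidableEq V] (he : e ∈ S) (hv : v ∈ e) (hX : v ∈ X)
    (h : Lasso (S.erase e) (X ∪ e)) : Lasso S X := by
  obtain ⟨l, u, f, w, h1, h2, h3, h4, h5, h6, h7⟩ := h
  have hel : e ∉ f :: l := by
    intro h
    rcases List.mem_cons.1 h with h | h
    · exact notMem_erase e S (h ▸ h3)
    · exact notMem_erase e S (h1.mem_of_mem e h)
  have hf := mem_of_mem_erase h3
  rcases h1.of_erase he hv hX with h | h
  -- Here the walk starts in `X` itself. If it closes only because `w` lies on `e`, then `e` is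
  -- taken as one more edge: it leads from `w` back to `v ∈ X`.
  · by_cases hw : w ∈ X ∨ ∃ g ∈ l, w ∈ g
    · exact ⟨l, u, f, w, h, h2, hf, h4, h5, h6, hw⟩
    · have hwe : w ∈ e := by
        rw [mem_union] at h7
        by_contra hwe
        exact hw (h7.imp_left fun h => h.resolve_right hwe)
      refine ⟨f :: l, w, e, v, .cons h hf h4 h5 h6, List.nodup_cons.2 ⟨hel, h2⟩, he, hwe, hv, ?_,
        Or.inl hX⟩
      rintro rfl
      exact hw (Or.inl hX)
  · refine ⟨l ++ [e], u, f, w, h, ?_, hf, h4, h5, h6, ?_⟩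
    · rw [← List.cons_append, List.nodup_append]
      refine ⟨h2, List.nodup_singleton e, ?_⟩
      rintro a ha b hb rfl
      rw [List.mem_singleton] at hb
      exact hel (hb ▸ ha)
    · rcases h7 with h7 | ⟨g, hg, hw⟩
      · rcases mem_union.1 h7 with h7 | h7
        · exact Or.inl h7
        · exact Or.inr ⟨e, by simp, h7⟩
      · exact Or.inr ⟨g, by simp [hg], hw⟩

/-- Without a lasso, an explored edge has exactly one vertex in the root set, since a second one
would close a lasso of length one. By `Lasso.of_erase` the absence of lassos survives the
exploration step, so no inequality of `card_reach_le` is lost. -/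
theorem card_reach_eq [Fintype V] [DecidableEq V] {d : ℕ} (hd : 1 ≤ d) (X : Finset V)
    (S : Finset (Finset V)) (hS : ∀ e ∈ S, #e = d) (h : ¬ Lasso S X) :
    #(reach X S) = #X + (d - 1) * #(inner X S) := by
  induction hn : #S generalizing X S with
  | zero =>
    rw [card_eq_zero] at hn
    subst hn
    rw [reach_eq_self (by simp)]
    simp [inner]
  | succ n ih =>
    by_cases h' : ∃ e ∈ S, ∃ v ∈ e, v ∈ X
    · obtain ⟨e, he, v, hv, hX⟩ := h'
      have h1 := ih (X ∪ e) (S.erase e) (fun f hf => hS f (mem_of_mem_erase hf))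
        (fun hl => h (hl.of_erase he hv hX)) (by rw [card_erase_of_mem he]; omega)
      rw [reach_erase he hv hX] at h1
      have h2 : X ∩ e = {v} := by
        refine Finset.eq_singleton_iff_unique_mem.2 ⟨mem_inter.2 ⟨hX, hv⟩, fun w hw => ?_⟩
        rw [mem_inter] at hw
        by_contra hne
        exact h ⟨[], v, e, w, .nil hX, by simp, he, hv, hw.2, hne, Or.inl hw.1⟩
      have h3 := card_union_add_card_inter X e
      have h4 := hS e he
      rw [h2, card_singleton] at h3
      rw [card_inner_erase he hv hX, mul_add, mul_one]
      omega
    · push Not at h'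
      rw [reach_eq_self h', inner_eq_empty (fun e he => card_pos.1 (by rw [hS e he]; omega)) h']
      simp

/-- A walk without repeated edges can be cut down to one that starts at a prescribed vertex of one
of its edges. -/
theorem Trail.exists_seq (h : Trail S X l v) (hl : l.Nodup) (hw : ∃ f ∈ l, w ∈ f) :
    ∃ (k : ℕ) (a : ℕ → V) (b : ℕ → Finset V), a 0 = w ∧ a k = v ∧
      (∀ i < k, b i ∈ l ∧ a i ∈ b i ∧ a (i + 1) ∈ b i ∧ a i ≠ a (i + 1)) ∧
      ∀ i < k, ∀ j < k, b i = b j → i = j := by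
  induction h with
  | nil _ => simp at hw
  | @cons l v u e _ he h1 h2 h3 ih =>
    rw [List.nodup_cons] at hl
    by_cases hw' : ∃ f ∈ l, w ∈ f
    · obtain ⟨k, a, b, h0, hk, hab, hinj⟩ := ih hl.2 hw'
      refine ⟨k + 1, fun i => if i ≤ k then a i else u, fun i => if i < k then b i else e,
        by simpa using h0, by simp, ?_, ?_⟩
      · intro i hi
        by_cases hik : i < k
        · have := hab i hik
          simp only [hik, hik.le, Nat.succ_le_of_lt hik, if_true]
          exact ⟨List.mem_cons_of_mem _ this.1, this.2⟩
        · have : i = k := by omega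
          subst this
          simpa [hk] using ⟨h1, h2, h3.symm⟩
      · intro i hi j hj hij
        by_cases hik : i < k <;> by_cases hjk : j < k <;> simp only [hik, hjk, if_true, if_false] at hij
        · exact hinj i hik j hjk hij
        · exact absurd (hij ▸ (hab i hik).1) hl.1
        · exact absurd (hij ▸ (hab j hjk).1) hl.1
        · omega
    · have hwe : w ∈ e := by
        obtain ⟨f, hf, hwf⟩ := hw
        rcases List.mem_cons.1 hf with rfl | hf
        · exact hwf
        · exact absurd ⟨f, hf, hwf⟩ hw'
      by_cases hwu : w = u
      · exact ⟨0, fun _ => w, fun _ => e, rfl, hwu, by simp, by simp⟩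
      · refine ⟨1, fun i => if i = 0 then w else u, fun _ => e, by simp, by simp, ?_, ?_⟩
        · intro i hi
          obtain rfl : i = 0 := by omega
          simpa using ⟨hwe, h2, hwu⟩
        · intro i hi j hj _
          omega

/-- A closed walk with `k` distinct edges in `S`, in which consecutive vertices are distinct. -/
def IsClosedWalk (S : Finset (Finset V)) (k : ℕ) [NeZero k] (a : Fin k → V)
    (b : Fin k → Finset V) : Prop :=
  Function.Injective b ∧ ∀ i, b i ∈ S ∧ a i ∈ b i ∧ a (i + 1) ∈ b i ∧ a i ≠ a (i + 1)

theorem Lasso.exists_isClosedWalk {x : V} (h : Lasso S {x}) :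
    ∃ (k : ℕ) (a : Fin (k + 2) → V) (b : Fin (k + 2) → Finset V), IsClosedWalk S (k + 2) a b := by
  obtain ⟨l, v, e, w, h1, h2, h3, h4, h5, h6, h7⟩ := h
  -- If the walk closes at its start `x`, then it has left `x`, because `w ≠ v`; its first edge
  -- contains `x`.
  have h7' : ∃ f ∈ l, w ∈ f := by
    rcases h7 with h7 | h7
    · rw [mem_singleton] at h7
      subst h7
      clear h2
      induction h1 with
      | nil h => exact absurd (mem_singleton.1 h).symm h6
      | @cons l v u f ht hf g1 g2 g3 ih =>
        by_cases hv : w = v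
        · exact ⟨f, by simp, hv ▸ g1⟩
        · by_cases hl : l = []
          · subst hl
            cases ht with
            | nil h => exact absurd (mem_singleton.1 h).symm hv
          · have : ∃ g ∈ l, w ∈ g := by
              clear ih h4 h6 hl g1 g3
              induction ht with
              | nil h => exact absurd (mem_singleton.1 h).symm hv
              | @cons l v' u' f' ht' hf' g1' g2' g3' ih' =>
                by_cases hv' : w = v'
                · exact ⟨f', by simp, hv' ▸ g1'⟩
                · obtain ⟨g, hg, hwg⟩ := ih' hv'
                  exact ⟨g, List.mem_cons_of_mem _ hg, hwg⟩
            obtain ⟨g, hg, hwg⟩ := this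
            exact ⟨g, List.mem_cons_of_mem _ hg, hwg⟩
    · exact h7
  rw [List.nodup_cons] at h2
  obtain ⟨k, a, b, h0, hk, hab, hinj⟩ := h1.exists_seq h2.2 h7'
  have hk0 : k ≠ 0 := by
    rintro rfl
    exact h6 (h0.symm.trans hk)
  obtain ⟨k, rfl⟩ := Nat.exists_eq_succ_of_ne_zero hk0
  -- The walk from `w` to `v` has `k + 1` edges, and `e` joins `v` to `w` as the edge with index `k
  -- + 1`.
  refine ⟨k, fun i => a i, fun i => if (i : ℕ) < k + 1 then b i else e, ?_, ?_⟩
  · intro i j hij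
    have hi := i.2
    have hj := j.2
    apply Fin.ext
    by_cases hik : (i : ℕ) < k + 1 <;> by_cases hjk : (j : ℕ) < k + 1 <;>
      simp only [hik, hjk, if_true, if_false] at hij
    · exact hinj i hik j hjk hij
    · exact absurd (hij ▸ (hab i hik).1) h2.1
    · exact absurd (hij ▸ (hab j hjk).1) h2.1
    · omega
  · intro i
    by_cases hik : (i : ℕ) < k + 1
    · have hval : ((i + 1 : Fin (k + 2)) : ℕ) = i + 1 := by
        rw [Fin.val_add_one, if_neg]
        intro h
        rw [h] at hik
        simp at hik
      have := hab i hik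
      simp only [hik, if_true, hval]
      exact ⟨h1.mem_of_mem _ this.1, this.2⟩
    · have hi : i = Fin.last (k + 1) := by
        apply Fin.ext
        have := i.2
        rw [Fin.val_last]
        omega
      subst hi
      have hk' : a (k + 1) = v := hk
      simp only [Fin.last_add_one, Fin.val_last, lt_irrefl, if_false, Fin.val_zero, hk', h0]
      exact ⟨h3, h4, h5, h6.symm⟩

end Lasso

/-! ### Labelled loose cycles -/

section LooseCycle

variable {V : Type*} [DecidableEq V] {s k : ℕ}

/-- The labels of the vertices of a loose cycle with `k + 2` edges of size `s + 2`: the link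
vertices, and the `s` private vertices of each edge. -/
abbrev CycleIndex (s k : ℕ) : Type := Fin (k + 2) ⊕ Fin (k + 2) × Fin s

/-- The edge number `i` of a labelled loose cycle. -/
def cycleEdge (g : CycleIndex s k ↪ V) (i : Fin (k + 2)) : Finset V :=
  insert (g (.inl i)) (insert (g (.inl (i + 1))) (univ.image fun a => g (.inr (i, a))))

/-- The edges of a labelled loose cycle. -/
def cycleEdges (g : CycleIndex s k ↪ V) : Finset (Finset V) := univ.image (cycleEdge g)

variable {g g' : CycleIndex s k ↪ V} {i j : Fin (k + 2)} {w : V}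

theorem mem_cycleEdge : w ∈ cycleEdge g i ↔
    w = g (.inl i) ∨ w = g (.inl (i + 1)) ∨ ∃ a, g (.inr (i, a)) = w := by
  simp [cycleEdge]

theorem mem_cycleEdges {e : Finset V} : e ∈ cycleEdges g ↔ ∃ i, cycleEdge g i = e := by
  simp [cycleEdges]

theorem left_mem_cycleEdge : g (.inl i) ∈ cycleEdge g i := mem_cycleEdge.2 (Or.inl rfl)

theorem right_mem_cycleEdge : g (.inl (i + 1)) ∈ cycleEdge g i :=
  mem_cycleEdge.2 (Or.inr (Or.inl rfl))

theorem private_mem_cycleEdge {a : Fin s} : g (.inr (i, a)) ∈ cycleEdge g i :=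
  mem_cycleEdge.2 (Or.inr (Or.inr ⟨a, rfl⟩))

theorem fin_add_one_ne (i : Fin (k + 2)) : i + 1 ≠ i := by
  intro h
  simp at h

theorem eq_link_of_mem (hi : w ∈ cycleEdge g i) (hj : w ∈ cycleEdge g j) (hij : i ≠ j) :
    w = g (.inl i) ∨ w = g (.inl (i + 1)) := by
  rcases mem_cycleEdge.1 hi with h | h | ⟨a, rfl⟩
  · exact Or.inl h
  · exact Or.inr h
  · rcases mem_cycleEdge.1 hj with h | h | ⟨b, h⟩
    · simpa using g.injective h
    · simpa using g.injective h
    · have := g.injective h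
      simp only [Sum.inr.injEq, Prod.mk.injEq] at this
      exact absurd this.1.symm hij

/-- A private vertex identifies its edge. Here `s ≥ 1`, that is `d ≥ 3`, enters; it also makes the
loose cycle with two edges, `k = 0`, a genuine one. -/
theorem cycleEdge_injective (hs : 1 ≤ s) (g : CycleIndex s k ↪ V) :
    Function.Injective (cycleEdge g) := by
  intro i j hij
  by_contra hne
  have h : g (.inr (i, ⟨0, hs⟩)) ∈ cycleEdge g i := private_mem_cycleEdge
  rcases eq_link_of_mem h (hij ▸ h) hne with h | h <;> simpa using g.injective h

theorem card_cycleEdge : #(cycleEdge g i) = s + 2 := by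
  rw [cycleEdge, card_insert_of_notMem, card_insert_of_notMem, card_image_of_injective,
    card_univ, Fintype.card_fin]
  · intro a b h
    simpa using g.injective h
  · simp
  · simp

theorem card_cycleEdges (hs : 1 ≤ s) : #(cycleEdges g) = k + 2 := by
  rw [cycleEdges, card_image_of_injective _ (cycleEdge_injective hs g), card_univ,
    Fintype.card_fin]

theorem biUnion_cycleEdges : (cycleEdges g).biUnion id = univ.map g := by
  ext w
  simp only [mem_biUnion, mem_cycleEdges, id, Finset.mem_map, mem_univ, true_and]
  constructor
  · rintro ⟨_, ⟨i, rfl⟩, hw⟩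
    rcases mem_cycleEdge.1 hw with rfl | rfl | ⟨a, rfl⟩ <;> exact ⟨_, rfl⟩
  · rintro ⟨i | ⟨i, a⟩, rfl⟩
    · exact ⟨_, ⟨i, rfl⟩, left_mem_cycleEdge⟩
    · exact ⟨_, ⟨i, rfl⟩, private_mem_cycleEdge⟩

theorem card_biUnion_cycleEdges : #((cycleEdges g).biUnion id) = (k + 2) * (s + 1) := by
  rw [biUnion_cycleEdges, card_map, card_univ]
  simp
  ring

theorem left_mem_cycleEdge_sub_one : g (.inl i) ∈ cycleEdge g (i - 1) := by
  have h : g (.inl (i - 1 + 1)) ∈ cycleEdge g (i - 1) := right_mem_cycleEdge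
  rwa [sub_add_cancel] at h

theorem fin_sub_one_ne (i : Fin (k + 2)) : i - 1 ≠ i := fun h =>
  fin_add_one_ne i (by rw [sub_eq_iff_eq_add] at h; exact h.symm)

theorem mem_reach_cycle [Fintype V] {S : Finset (Finset V)} (hC : cycleEdges g ⊆ S) :
    (cycleEdges g).biUnion id ⊆ reach {g (.inl 0)} S := by
  have h0 : ∀ n : ℕ, g (.inl (Fin.ofNat (k + 2) n)) ∈ reach {g (.inl 0)} S := by
    intro n
    induction n with
    | zero => exact subset_reach (mem_singleton_self _)
    | succ n ih =>
      have := edge_subset_reach (hC (mem_cycleEdges.2 ⟨_, rfl⟩)) left_mem_cycleEdge ih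
        right_mem_cycleEdge
      convert this using 3
      simp [Fin.ext_iff, Fin.val_add]
  intro w hw
  simp only [mem_biUnion, mem_cycleEdges, id] at hw
  obtain ⟨_, ⟨i, rfl⟩, hw⟩ := hw
  have := h0 i
  rw [Fin.ofNat_val_eq_self] at this
  exact edge_subset_reach (hC (mem_cycleEdges.2 ⟨i, rfl⟩)) left_mem_cycleEdge this hw

end LooseCycle

/-! ### Unicyclic components and their unique loose cycle -/

section Unicyclic

variable {V : Type*} [Fintype V]

/-- The component of `x` is unicyclic. -/
def Unicyclic (d : ℕ) (S : Finset (Finset V)) (x : V) : Prop :=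
  (d - 1) * #(inner {x} S) = #(reach {x} S)

open Classical in
/-- The vertex sets of the unicyclic components. -/
noncomputable def unicycles (d : ℕ) (S : Finset (Finset V)) : Finset (Finset V) :=
  ({x | Unicyclic d S x} : Finset V).image fun x => reach {x} S

variable {s k d : ℕ} {S : Finset (Finset V)} {x y : V} {X : Finset V}

theorem mem_unicycles {K : Finset V} :
    K ∈ unicycles d S ↔ ∃ x, Unicyclic d S x ∧ reach {x} S = K := by
  simp [unicycles]

theorem unicyclic_iff_of_mem (h : y ∈ reach {x} S) : Unicyclic d S y ↔ Unicyclic d S x := by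
  rw [Unicyclic, Unicyclic, reach_eq_of_mem h, inner_eq_of_mem h]

variable [DecidableEq V]

/-- Once the vertices of `C` are roots, its edges are no longer needed for connection. A component
that contains a cycle is thus the reach of the cycle's vertices along the other edges. -/
theorem reach_sdiff {C : Finset (Finset V)} (hC : C.biUnion id ⊆ X) (hX : X ⊆ reach {x} S)
    (h0 : X.Nonempty) : reach X (S \ C) = reach {x} S := by
  apply Subset.antisymm
  · exact reach_subset hX fun e he _ hv h => edge_subset_reach (mem_sdiff.1 he).1 hv h
  · obtain ⟨v, hv⟩ := h0
    rw [← reach_eq_of_mem (hX hv)]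
    refine reach_subset (singleton_subset_iff.2 (subset_reach hv)) fun e he v hv h => ?_
    by_cases heC : e ∈ C
    · exact (subset_biUnion_of_mem id heC).trans (hC.trans subset_reach)
    · exact edge_subset_reach (mem_sdiff.2 ⟨he, heC⟩) hv h

theorem inner_sdiff {C : Finset (Finset V)} (hC : C.biUnion id ⊆ X) (hX : X ⊆ reach {x} S)
    (h0 : X.Nonempty) : inner X (S \ C) = inner {x} S \ C := by
  ext e
  simp only [mem_inner, Finset.mem_sdiff, reach_sdiff hC hX h0]
  tauto

theorem card_inner_sdiff {C : Finset (Finset V)} (hCS : C ⊆ S) (hC : C.biUnion id ⊆ X)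
    (hX : X ⊆ reach {x} S) (h0 : X.Nonempty) : #(inner {x} S) = #(inner X (S \ C)) + #C := by
  rw [inner_sdiff hC hX h0, card_sdiff_add_card_eq_card]
  exact fun e he => mem_inner.2 ⟨hCS he,
    (subset_biUnion_of_mem id he).trans (hC.trans hX)⟩

/-- A unicyclic component contains at most one loose cycle. -/
theorem cycleEdges_subset_of_unicyclic {k' : ℕ} (hs : 1 ≤ s) (hS : ∀ e ∈ S, #e = s + 2)
    {g : CycleIndex s k ↪ V} {g' : CycleIndex s k' ↪ V} (hg : cycleEdges g ⊆ S)
    (hg' : cycleEdges g' ⊆ S) (hu : Unicyclic (s + 2) S x)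
    (hx : g (.inl 0) ∈ reach {x} S) (hx' : g' (.inl 0) ∈ reach {x} S) :
    cycleEdges g' ⊆ cycleEdges g := by
  set X := (cycleEdges g).biUnion id with hXdef
  have hX : X ⊆ reach {x} S := by
    rw [← reach_eq_of_mem hx]
    exact mem_reach_cycle hg
  have hX' : (cycleEdges g').biUnion id ⊆ reach {x} S := by
    rw [← reach_eq_of_mem hx']
    exact mem_reach_cycle hg'
  have h0 : X.Nonempty := ⟨g (.inl 0), by rw [hXdef, biUnion_cycleEdges]; simp⟩
  -- A loose cycle has as many vertices as `s + 1` times its edges, so unicyclicity says that the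
  -- other edges of the component form a forest rooted at the cycle.
  have hcard : #(reach X (S \ cycleEdges g)) =
      #X + (s + 2 - 1) * #(inner X (S \ cycleEdges g)) := by
    rw [Unicyclic, card_inner_sdiff hg Subset.rfl hX h0, card_cycleEdges hs] at hu
    rw [reach_sdiff Subset.rfl hX h0, ← hu, hXdef, card_biUnion_cycleEdges, ← hXdef,
      show s + 2 - 1 = s + 1 by omega]
    ring
  by_contra hsub
  have hT0 : (cycleEdges g' \ cycleEdges g).Nonempty := sdiff_nonempty.2 hsub
  obtain ⟨e, he, hcard1⟩ := exists_card_inter_le_one (by omega) X (S \ cycleEdges g)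
    (fun e he => hS e (mem_sdiff.1 he).1) hcard (T := cycleEdges g' \ cycleEdges g)
    (by
      rw [inner_sdiff Subset.rfl hX h0]
      refine sdiff_subset_sdiff (fun e he => mem_inner.2 ⟨hg' he, ?_⟩) Subset.rfl
      exact (subset_biUnion_of_mem id he).trans hX') hT0
  obtain ⟨i, rfl⟩ := mem_cycleEdges.1 (mem_sdiff.1 he).1
  -- The edge number `i` of the second cycle has two link vertices, which also lie on its
  -- neighbours. Each neighbour belongs to the first cycle, hence lies in `X`, or to the other
  -- members of the difference. So this edge has two vertices where the forest property allows one.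
  have key : ∀ j ≠ i, ∀ w ∈ cycleEdge g' j,
      w ∈ X ∪ ((cycleEdges g' \ cycleEdges g).erase (cycleEdge g' i)).biUnion id := by
    intro j hj w hw
    by_cases hjg : cycleEdge g' j ∈ cycleEdges g
    · exact mem_union_left _ (mem_biUnion.2 ⟨_, hjg, hw⟩)
    · refine mem_union_right _ (mem_biUnion.2 ⟨_, mem_erase.2 ⟨?_, mem_sdiff.2
        ⟨mem_cycleEdges.2 ⟨j, rfl⟩, hjg⟩⟩, hw⟩)
      exact fun h => hj (cycleEdge_injective hs g' h)
  have h1 := card_le_one.1 hcard1 (g' (.inl i))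
    (mem_inter.2 ⟨left_mem_cycleEdge, key (i - 1) (fin_sub_one_ne i) _ left_mem_cycleEdge_sub_one⟩)
    (g' (.inl (i + 1)))
    (mem_inter.2 ⟨right_mem_cycleEdge, key (i + 1) (fin_add_one_ne i) _ left_mem_cycleEdge⟩)
  exact fin_add_one_ne i (Sum.inl_injective (g'.injective h1)).symm

/-- A loose cycle whose vertices are the roots of a forest completes this forest to a unicyclic
component. -/
theorem unicyclic_union_cycleEdges (hs : 1 ≤ s) (hS : ∀ e ∈ S, #e = s + 2)
    {g : CycleIndex s k ↪ V} (hd : Disjoint S (cycleEdges g))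
    (hl : ¬ Lasso S ((cycleEdges g).biUnion id)) :
    Unicyclic (s + 2) (S ∪ cycleEdges g) (g (.inl 0)) ∧
      #(unicycles (s + 2) (S ∪ cycleEdges g)) = #(unicycles (s + 2) S) + 1 := by
  set X := (cycleEdges g).biUnion id with hXdef
  set K := reach {g (.inl 0)} (S ∪ cycleEdges g) with hK
  have hX : X ⊆ K := mem_reach_cycle subset_union_right
  have h0 : X.Nonempty := ⟨g (.inl 0), by rw [hXdef, biUnion_cycleEdges]; simp⟩
  have hsd : (S ∪ cycleEdges g) \ cycleEdges g = S := by
    rw [union_sdiff_right, Finset.sdiff_eq_self_of_disjoint hd]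
  have hreach : reach X S = K := by
    rw [hK, ← reach_sdiff Subset.rfl hX h0, hsd]
  have hu : Unicyclic (s + 2) (S ∪ cycleEdges g) (g (.inl 0)) := by
    have h1 := card_inner_sdiff subset_union_right Subset.rfl hX h0
    have h2 := card_reach_eq (by omega) X S hS hl
    rw [hsd, card_cycleEdges hs] at h1
    rw [Unicyclic, h1, ← hK, ← hreach, h2, hXdef, card_biUnion_cycleEdges,
      show s + 2 - 1 = s + 1 by omega]
    ring
  refine ⟨hu, ?_⟩
  -- Before the cycle is added, the components inside `K` are trees, each with one vertex too many
  -- to be unicyclic. So `K` is new and no unicyclic component is destroyed.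
  have hin : ∀ y ∈ K, ¬ Unicyclic (s + 2) S y := by
    intro y hy hyu
    rw [← hreach] at hy
    obtain ⟨x, hx, hxy⟩ := mem_reach.1 hy
    rw [unicyclic_iff_of_mem (mem_reach_singleton.2 hxy), Unicyclic,
      card_reach_eq (d := s + 2) (by omega) {x} S hS
        (fun h => hl (h.mono Subset.rfl (singleton_subset_iff.2 hx)))] at hyu
    rw [card_singleton] at hyu
    omega
  have hout : ∀ y ∉ K, ∀ e ∈ cycleEdges g, ∀ v ∈ e, v ∉ reach {y} S := by
    intro y hy e he v hv hvy
    have h1 : v ∈ K := hX (mem_biUnion.2 ⟨e, he, hv⟩)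
    have h2 : v ∈ reach {y} (S ∪ cycleEdges g) :=
      reach_mono Subset.rfl subset_union_left hvy
    rw [hK, ← reach_eq_of_mem h1, reach_eq_of_mem h2] at hy
    exact hy (subset_reach (mem_singleton_self _))
  have hreach' : ∀ y ∉ K, reach {y} (S ∪ cycleEdges g) = reach {y} S := by
    intro y hy
    refine (reach_subset subset_reach fun e he v hv h => ?_).antisymm
      (reach_mono Subset.rfl subset_union_left)
    rcases mem_union.1 he with he | he
    · exact edge_subset_reach he hv h
    · exact absurd h (hout y hy e he v hv)
  have huni : ∀ y ∉ K, (Unicyclic (s + 2) (S ∪ cycleEdges g) y ↔ Unicyclic (s + 2) S y) := by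
    intro y hy
    have : inner {y} (S ∪ cycleEdges g) = inner {y} S := by
      ext e
      simp only [mem_inner, hreach' y hy, mem_union]
      refine ⟨fun h => ⟨h.1.resolve_right fun he => ?_, h.2⟩, fun h => ⟨Or.inl h.1, h.2⟩⟩
      obtain ⟨i, rfl⟩ := mem_cycleEdges.1 he
      exact hout y hy _ he _ left_mem_cycleEdge (h.2 left_mem_cycleEdge)
    rw [Unicyclic, Unicyclic, hreach' y hy, this]
  have himage : unicycles (s + 2) (S ∪ cycleEdges g) = insert K (unicycles (s + 2) S) := by
    ext A
    rw [mem_insert, mem_unicycles, mem_unicycles]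
    constructor
    · rintro ⟨y, hyu, rfl⟩
      by_cases hy : y ∈ K
      · exact Or.inl (reach_eq_of_mem hy)
      · exact Or.inr ⟨y, (huni y hy).1 hyu, (hreach' y hy).symm⟩
    · rintro (rfl | ⟨y, hyu, rfl⟩)
      · exact ⟨_, hu, rfl⟩
      · have hy : y ∉ K := fun hy => hin y hy hyu
        exact ⟨y, (huni y hy).2 hyu, hreach' y hy⟩
  rw [himage, card_insert_of_notMem]
  rintro hmem
  obtain ⟨y, hyu, hyK⟩ := mem_unicycles.1 hmem
  exact hin y (hyK ▸ subset_reach (mem_singleton_self y)) hyu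

/-- An edge set without closed walks has no unicyclic components. -/
theorem unicycles_eq_empty (hS : ∀ e ∈ S, #e = d) (hd : 1 ≤ d)
    (h : ∀ (k : ℕ) (a : Fin (k + 2) → V) (b : Fin (k + 2) → Finset V),
      ¬ IsClosedWalk S (k + 2) a b) : unicycles d S = ∅ := by
  refine Finset.eq_empty_of_forall_notMem fun K hK => ?_
  obtain ⟨x, hx, -⟩ := mem_unicycles.1 hK
  have := card_reach_eq hd {x} S hS fun hl => by
    obtain ⟨k, a, b, hab⟩ := hl.exists_isClosedWalk
    exact h k a b hab
  rw [Unicyclic, this, card_singleton] at hx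
  omega

end Unicyclic

/-! ### A lower bound for the number of loose cycles -/

section CountCycles

variable {V : Type*} [DecidableEq V] {s k : ℕ}

open Classical in
/-- The edge sets of the loose cycles with `k + 2` edges of size `s + 2` and vertices in `U`. -/
noncomputable def looseCycles (U : Finset V) (s k : ℕ) : Finset (Finset (Finset V)) :=
  univ.image fun g : CycleIndex s k ↪ U => cycleEdges (g.trans (Function.Embedding.subtype _))

theorem exists_of_mem_looseCycles {U : Finset V} {C : Finset (Finset V)}
    (hC : C ∈ looseCycles U s k) :
    ∃ g : CycleIndex s k ↪ V, cycleEdges g = C ∧ ∀ x, g x ∈ U := by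
  simp only [looseCycles, mem_image, mem_univ, true_and] at hC
  obtain ⟨g, rfl⟩ := hC
  exact ⟨_, rfl, fun x => (g x).2⟩

/-- The labels can be followed around the cycle: the next link is the other vertex that the current
edge shares with another edge, and the next edge is the other edge at this link. Hence a starting
link and a starting edge fix everything except the labels of private vertices. -/
theorem cycleEdge_eq_of_cycleEdges_eq {g g' : CycleIndex s k ↪ V} (hs : 1 ≤ s)
    (h : cycleEdges g = cycleEdges g') (hv : g (.inl 0) = g' (.inl 0))
    (he : cycleEdge g 0 = cycleEdge g' 0) (i : Fin (k + 2)) :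
    g (.inl i) = g' (.inl i) ∧ cycleEdge g i = cycleEdge g' i := by
  have key : ∀ n : ℕ, g (.inl (Fin.ofNat (k + 2) n)) = g' (.inl (Fin.ofNat (k + 2) n)) ∧
      cycleEdge g (Fin.ofNat (k + 2) n) = cycleEdge g' (Fin.ofNat (k + 2) n) := by
    intro n
    induction n with
    | zero => exact ⟨hv, he⟩
    | succ n ih =>
      have hn : Fin.ofNat (k + 2) (n + 1) = Fin.ofNat (k + 2) n + 1 := by
        simp [Fin.ext_iff, Fin.val_add]
      rw [hn]
      set i := Fin.ofNat (k + 2) n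
      obtain ⟨hvi, hei⟩ := ih
      have hmem : ∀ m, ∃ j, cycleEdge g j = cycleEdge g' m := fun m =>
        mem_cycleEdges.1 (h ▸ mem_cycleEdges.2 ⟨m, rfl⟩)
      obtain ⟨j, hj⟩ := hmem (i + 1)
      have hji : i ≠ j := by
        rintro rfl
        rw [hei] at hj
        exact fin_add_one_ne i (cycleEdge_injective hs g' hj).symm
      have h1 : g' (.inl (i + 1)) ∈ cycleEdge g i := by
        rw [hei]
        exact right_mem_cycleEdge
      have h2 : g' (.inl (i + 1)) ∈ cycleEdge g j := by
        rw [hj]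
        exact left_mem_cycleEdge
      have hv1 : g (.inl (i + 1)) = g' (.inl (i + 1)) := by
        rcases eq_link_of_mem h1 h2 hji with h3 | h3
        · rw [hvi] at h3
          exact absurd (Sum.inl_injective (g'.injective h3)) (fin_add_one_ne i)
        · exact h3.symm
      refine ⟨hv1, ?_⟩
      rw [← hj]
      by_contra hne
      have hij : j ≠ i + 1 := by
        rintro rfl
        exact hne rfl
      rw [← hv1] at h2
      rcases eq_link_of_mem h2 left_mem_cycleEdge hij with h3 | h3
      · exact hij (Sum.inl_injective (g.injective h3)).symm
      · exact hji (add_right_cancel (Sum.inl_injective (g.injective h3)))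
  have := key i
  rwa [Fin.ofNat_val_eq_self] at this

theorem image_private {g : CycleIndex s k ↪ V} (i : Fin (k + 2)) :
    (univ.image fun a => g (.inr (i, a))) =
      ((cycleEdge g i).erase (g (.inl i))).erase (g (.inl (i + 1))) := by
  ext w
  simp only [mem_image, mem_univ, true_and, mem_erase, mem_cycleEdge]
  constructor
  · rintro ⟨a, rfl⟩
    simp
  · rintro ⟨h1, h2, h3⟩
    tauto

variable [Fintype V]

open Classical in
theorem card_cycles_flag_le (hs : 1 ≤ s) (C : Finset (Finset V)) (f : V × Finset V) :
    #{g : CycleIndex s k ↪ V | cycleEdges g = C ∧ (g (.inl 0), cycleEdge g 0) = f} ≤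
      s.factorial ^ (k + 2) := by
  by_cases hex : ∃ g : CycleIndex s k ↪ V, cycleEdges g = C ∧ (g (.inl 0), cycleEdge g 0) = f
  · obtain ⟨g₀, h1, h2⟩ := hex
    have hbase : ∀ g : CycleIndex s k ↪ V,
        cycleEdges g = C ∧ (g (.inl 0), cycleEdge g 0) = f → ∀ i,
        g (.inl i) = g₀ (.inl i) ∧ cycleEdge g i = cycleEdge g₀ i := by
      rintro g ⟨h3, h4⟩
      rw [← h2, Prod.mk.injEq] at h4
      exact cycleEdge_eq_of_cycleEdges_eq hs (h3.trans h1.symm) h4.1 h4.2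
    have hpriv : ∀ g : CycleIndex s k ↪ V,
        cycleEdges g = C ∧ (g (.inl 0), cycleEdge g 0) = f → ∀ i a,
        g (.inr (i, a)) ∈ univ.image fun a => g₀ (.inr (i, a)) := by
      intro g hg i a
      rw [image_private, ← (hbase g hg i).1, ← (hbase g hg i).2, ← (hbase g hg (i + 1)).1,
        ← image_private]
      exact mem_image_of_mem _ (mem_univ a)
    rw [← Fintype.card_subtype]
    let F : {g : CycleIndex s k ↪ V // cycleEdges g = C ∧ (g (.inl 0), cycleEdge g 0) = f} →
        ((i : Fin (k + 2)) → (Fin s ↪ (univ.image fun a => g₀ (.inr (i, a)) : Finset V))) :=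
      fun g i => ⟨fun a => ⟨g.1 (.inr (i, a)), hpriv g.1 g.2 i a⟩, fun a b hab => by
        simpa using g.1.injective (congrArg Subtype.val hab)⟩
    have hF : Function.Injective F := by
      intro g g' hgg
      apply Subtype.ext
      ext x
      rcases x with i | ⟨i, a⟩
      · rw [(hbase g.1 g.2 i).1, (hbase g'.1 g'.2 i).1]
      · have := congrArg (fun φ => ((φ i) a : V)) hgg
        exact this
    refine (Fintype.card_le_of_injective F hF).trans ?_
    rw [Fintype.card_pi]
    have : ∀ i, #(univ.image fun a => g₀ (.inr (i, a))) = s := by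
      intro i
      rw [card_image_of_injective, card_univ, Fintype.card_fin]
      intro a b hab
      simpa using g₀.injective hab
    simp only [Fintype.card_embedding_eq, Fintype.card_fin, Fintype.card_coe, this,
      Nat.descFactorial_self, prod_const, card_univ]
    exact le_rfl
  · push Not at hex
    rw [filter_false_of_mem]
    · simp
    · rintro g - ⟨h1, h2⟩
      exact hex g h1 h2

-- The starting flag consists of an edge and one of its two links, which leaves at most `2 (k + 2)`
-- choices; for each flag the private vertices can be permuted within each of the `k + 2` edges.
open Classical in
theorem card_cycles_le (hs : 1 ≤ s) (C : Finset (Finset V)) :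
    #{g : CycleIndex s k ↪ V | cycleEdges g = C} ≤ 2 * (k + 2) * s.factorial ^ (k + 2) := by
  by_cases hex : ∃ g : CycleIndex s k ↪ V, cycleEdges g = C
  · obtain ⟨g₀, rfl⟩ := hex
    let flags : Finset (V × Finset V) :=
      (univ.image fun i => (g₀ (.inl i), cycleEdge g₀ i)) ∪
        univ.image fun i => (g₀ (.inl (i + 1)), cycleEdge g₀ i)
    have hflags : #flags ≤ 2 * (k + 2) := by
      refine (card_union_le _ _).trans ?_
      have h1 := card_image_le (s := univ) (f := fun i => (g₀ (.inl i), cycleEdge g₀ i))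
      have h2 := card_image_le (s := univ) (f := fun i => (g₀ (.inl (i + 1)), cycleEdge g₀ i))
      rw [card_univ, Fintype.card_fin] at h1 h2
      omega
    have hmaps : ∀ g ∈ ({g : CycleIndex s k ↪ V | cycleEdges g = cycleEdges g₀} : Finset _),
        (g (.inl 0), cycleEdge g 0) ∈ flags := by
      intro g hg
      rw [mem_filter] at hg
      obtain ⟨i, hi⟩ := mem_cycleEdges.1 (hg.2 ▸ mem_cycleEdges.2 ⟨0, rfl⟩ :
        cycleEdge g 0 ∈ cycleEdges g₀)
      obtain ⟨j, hj⟩ := mem_cycleEdges.1 (hg.2 ▸ mem_cycleEdges.2 ⟨0 - 1, rfl⟩ :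
        cycleEdge g (0 - 1) ∈ cycleEdges g₀)
      have hij : i ≠ j := by
        rintro rfl
        exact fin_sub_one_ne 0 (cycleEdge_injective hs g (hj.symm.trans hi))
      have h1 : g (.inl 0) ∈ cycleEdge g₀ i := by
        rw [hi]
        exact left_mem_cycleEdge
      have h2 : g (.inl 0) ∈ cycleEdge g₀ j := by
        rw [hj]
        exact left_mem_cycleEdge_sub_one
      rw [← hi]
      rcases eq_link_of_mem h1 h2 hij with h | h
      · rw [h]
        exact mem_union_left _ (mem_image_of_mem _ (mem_univ i))
      · rw [h]
        exact mem_union_right _ (mem_image_of_mem (fun i => (g₀ (.inl (i + 1)), cycleEdge g₀ i))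
          (mem_univ i))
    rw [card_eq_sum_card_fiberwise hmaps]
    refine (sum_le_card_nsmul _ _ (s.factorial ^ (k + 2)) fun f _ => ?_).trans ?_
    · rw [filter_filter]
      exact card_cycles_flag_le hs _ f
    · rw [smul_eq_mul]
      exact Nat.mul_le_mul_right _ hflags
  · push Not at hex
    rw [filter_false_of_mem fun g _ => hex g]
    simp

theorem descFactorial_le_card_looseCycles (hs : 1 ≤ s) (U : Finset V) :
    (#U).descFactorial ((k + 2) * (s + 1)) ≤
      2 * (k + 2) * s.factorial ^ (k + 2) * #(looseCycles U s k) := by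
  classical
  have h1 : (#U).descFactorial ((k + 2) * (s + 1)) = Fintype.card (CycleIndex s k ↪ U) := by
    rw [Fintype.card_embedding_eq]
    congr 1
    · simp
    · simp
      ring
  rw [h1, ← card_univ, card_eq_sum_card_image fun g : CycleIndex s k ↪ U =>
    cycleEdges (g.trans (Function.Embedding.subtype _))]
  refine (sum_le_card_nsmul _ _ (2 * (k + 2) * s.factorial ^ (k + 2)) fun C _ => ?_).trans ?_
  · refine le_trans ?_ (card_cycles_le hs C)
    refine card_le_card_of_injOn (fun g => g.trans (Function.Embedding.subtype _)) ?_ ?_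
    · intro g hg
      simpa using hg
    · intro g _ g' _ hgg
      ext x
      exact congrArg (fun φ => φ x) hgg
  · rw [smul_eq_mul, mul_comm, looseCycles]

end CountCycles

/-! ### Closed walks and the lower bound for having no unicyclic component -/

section Counting

variable {V : Type*} [DecidableEq V] {s k : ℕ} {U X : Finset V} {v w : V} {p : ℝ}

theorem card_edges_pair_le (hvw : v ≠ w) :
    #{e ∈ powersetCard (s + 2) U | v ∈ e ∧ w ∈ e} ≤ (#U - 2).choose s := by
  by_cases h : v ∈ U ∧ w ∈ U
  · have h1 : #((U.erase v).erase w) = #U - 2 := by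
      rw [card_erase_of_mem (mem_erase.2 ⟨hvw.symm, h.2⟩), card_erase_of_mem h.1]
      omega
    rw [← h1, ← card_powersetCard]
    refine card_le_card_of_injOn (fun e => (e.erase v).erase w) ?_ ?_
    · intro e he
      simp only [coe_filter, Set.mem_ofPred_eq, mem_powersetCard] at he
      simp only [mem_coe, mem_powersetCard]
      refine ⟨erase_subset_erase _ (erase_subset_erase _ he.1.1), ?_⟩
      rw [card_erase_of_mem (mem_erase.2 ⟨hvw.symm, he.2.2⟩), card_erase_of_mem he.2.1, he.1.2]
      omega
    · intro e he f hf hef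
      simp only [coe_filter, Set.mem_ofPred_eq] at he hf
      have h2 : ∀ g : Finset V, v ∈ g → w ∈ g → insert v (insert w ((g.erase v).erase w)) = g := by
        intro g hv hw
        rw [insert_erase (mem_erase.2 ⟨hvw.symm, hw⟩), insert_erase hv]
      have hef' : (e.erase v).erase w = (f.erase v).erase w := hef
      rw [← h2 e he.2.1 he.2.2, hef', h2 f hf.2.1 hf.2.2]
  · rw [filter_false_of_mem]
    · simp
    · intro e he hvwe
      have := (mem_powersetCard.1 he).1
      exact h ⟨this hvwe.1, this hvwe.2⟩

variable [Fintype V]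

open Classical in
/-- The closed walks with `k + 2` edges of size `s + 2` and vertices in `U`. -/
noncomputable def closedWalks (U : Finset V) (s k : ℕ) :
    Finset ((Fin (k + 2) → V) × (Fin (k + 2) → Finset V)) :=
  {x | IsClosedWalk (powersetCard (s + 2) U) (k + 2) x.1 x.2}

/-- The vertices are chosen freely, and each edge must then contain two prescribed distinct
vertices. Repeated vertices are permitted in a closed walk, which keeps the bound a pure power. -/
theorem card_closedWalks_le :
    #(closedWalks U s k) ≤ (#U * (#U - 2).choose s) ^ (k + 2) := by
  classical
  rw [mul_comm, mul_pow]
  have h1 : #(Fintype.piFinset fun _ : Fin (k + 2) => U) = #U ^ (k + 2) := by simp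
  rw [← h1]
  refine card_le_mul_card_image_of_maps_to (f := Prod.fst) ?_ _ fun a ha => ?_
  · rintro ⟨a, b⟩ h
    simp only [closedWalks, mem_filter] at h
    rw [Fintype.mem_piFinset]
    intro i
    exact (mem_powersetCard.1 (h.2.2 i).1).1 (h.2.2 i).2.1
  · by_cases hne : ∀ i, a i ≠ a (i + 1)
    · refine le_trans ?_ (Finset.prod_le_pow_card (univ : Finset (Fin (k + 2)))
        (fun i => #{e ∈ powersetCard (s + 2) U | a i ∈ e ∧ a (i + 1) ∈ e}) _
          fun i _ => card_edges_pair_le (hne i)) |>.trans_eq (by simp)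
      rw [← Fintype.card_piFinset]
      refine card_le_card_of_injOn Prod.snd ?_ ?_
      · rintro ⟨a', b⟩ h
        simp only [closedWalks, coe_filter, mem_filter, Set.mem_ofPred_eq] at h
        obtain ⟨⟨-, h⟩, rfl⟩ := h
        simp only [mem_coe, Fintype.mem_piFinset, mem_filter]
        exact fun i => ⟨(h.2 i).1, (h.2 i).2.1, (h.2 i).2.2.1⟩
      · rintro ⟨a', b⟩ h ⟨a'', b'⟩ h' hbb
        simp only [coe_filter, Set.mem_ofPred_eq] at h h'
        obtain rfl := h.2
        obtain rfl := h'.2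
        exact Prod.ext rfl hbb
    · push Not at hne
      obtain ⟨i, hi⟩ := hne
      rw [filter_false_of_mem]
      · simp
      · rintro ⟨a', b⟩ h rfl
        simp only [closedWalks, mem_filter] at h
        exact (h.2.2 i).2.2.2 hi

/-- The rotations and reflections of a closed walk. -/
def dihedral {α β : Type*} {k : ℕ} (a : Fin (k + 2) → α) (b : Fin (k + 2) → β)
    (t : Fin (k + 2) × Bool) : (Fin (k + 2) → α) × (Fin (k + 2) → β) :=
  if t.2 then (fun i => a (t.1 - i), fun i => b (t.1 - i - 1))
  else (fun i => a (i + t.1), fun i => b (i + t.1))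

open Classical in
/-- The edge sets of the closed walks. -/
noncomputable def closedWalkEdges (U : Finset V) (s k : ℕ) : Finset (Finset (Finset V)) :=
  (closedWalks U s k).image fun x => univ.image x.2

/-- The `2 (k + 2)` rotations and reflections of a closed walk have the same edge set. Their entries
at index `0` distinguish them: equal edges fix the shift within each kind, and a rotation cannot
agree with a reflection because consecutive vertices differ. -/
theorem mul_card_closedWalkEdges_le :
    2 * (k + 2) * #(closedWalkEdges U s k) ≤ #(closedWalks U s k) := by
  classical
  refine mul_card_image_le_card_of_maps_to (s := closedWalks U s k)
    (f := fun x => univ.image x.2)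
    (fun x hx => mem_image_of_mem (fun x : (Fin (k + 2) → V) × (Fin (k + 2) → Finset V) =>
      univ.image x.2) hx) _ fun B hB => ?_
  obtain ⟨⟨a, b⟩, hx, rfl⟩ := mem_image.1 hB
  simp only [closedWalks, mem_filter, mem_univ, true_and] at hx
  obtain ⟨hinj, hab⟩ := hx
  have hcard : #(univ : Finset (Fin (k + 2) × Bool)) = 2 * (k + 2) := by
    simp
    ring
  rw [← hcard]
  refine card_le_card_of_injOn (dihedral a b) ?_ ?_
  · rintro ⟨j, c⟩ -
    simp only [coe_filter, Set.mem_ofPred_eq, closedWalks, mem_filter, mem_univ, true_and]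
    cases c
    · refine ⟨⟨fun i i' h => add_right_cancel (hinj h), fun i => ?_⟩, ?_⟩
      · have := hab (i + j)
        rw [show i + j + 1 = i + 1 + j by abel] at this
        exact this
      · ext e
        simp only [dihedral, Bool.false_eq_true, if_false, mem_image, mem_univ, true_and]
        exact ⟨fun ⟨i, hi⟩ => ⟨_, hi⟩, fun ⟨i, hi⟩ => ⟨i - j, by rw [sub_add_cancel, hi]⟩⟩
    · refine ⟨⟨fun i i' h => ?_, fun i => ?_⟩, ?_⟩
      · exact sub_right_injective (sub_left_injective (hinj h))
      · have := hab (j - i - 1)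
        rw [sub_add_cancel] at this
        refine ⟨this.1, this.2.2.1, ?_, ?_⟩
        · simpa [dihedral, sub_sub] using this.2.1
        · simpa [dihedral, sub_sub] using this.2.2.2.symm
      · ext e
        simp only [dihedral, if_true, mem_image, mem_univ, true_and]
        exact ⟨fun ⟨i, hi⟩ => ⟨_, hi⟩, fun ⟨i, hi⟩ => ⟨j - i - 1, by
          rw [show j - (j - i - 1) - 1 = i by abel, hi]⟩⟩
  · rintro ⟨j, c⟩ - ⟨j', c'⟩ - h
    have ha : ∀ i, (dihedral a b (j, c)).1 i = (dihedral a b (j', c')).1 i := fun i => by rw [h]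
    have hb : ∀ i, (dihedral a b (j, c)).2 i = (dihedral a b (j', c')).2 i := fun i => by rw [h]
    have ha0 := ha 0
    have hb0 := hb 0
    cases c <;> cases c' <;>
      simp only [dihedral, Bool.false_eq_true, if_true, if_false, zero_add, sub_zero] at ha0 hb0
    · rw [hinj hb0]
    · rw [hinj hb0] at ha0
      have := (hab (j' - 1)).2.2.2
      rw [sub_add_cancel] at this
      exact absurd ha0 this
    · rw [← hinj hb0] at ha0
      have := (hab (j - 1)).2.2.2
      rw [sub_add_cancel] at this
      exact absurd ha0.symm this
    · rw [sub_left_injective (hinj hb0)]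

theorem card_closedWalkEdges_le (hp0 : 0 ≤ p) :
    #(closedWalkEdges U s k) * p ^ (k + 2) ≤
      (#U * (#U - 2).choose s * p) ^ (k + 2) / (2 * ((k : ℝ) + 2)) := by
  have h : 2 * (k + 2) * #(closedWalkEdges U s k) ≤ (#U * (#U - 2).choose s) ^ (k + 2) :=
    mul_card_closedWalkEdges_le.trans card_closedWalks_le
  have h' : 2 * ((k : ℝ) + 2) * #(closedWalkEdges U s k) ≤
      ((#U : ℝ) * ((#U - 2).choose s : ℕ)) ^ (k + 2) := by exact_mod_cast h
  rw [le_div_iff₀ (by positivity), mul_pow _ p]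
  have := mul_le_mul_of_nonneg_right h' (pow_nonneg hp0 (k + 2))
  linarith

theorem mem_closedWalkEdges {B : Finset (Finset V)} (h : B ∈ closedWalkEdges U s k) :
    B ⊆ powersetCard (s + 2) U ∧ #B = k + 2 := by
  classical
  obtain ⟨⟨a, b⟩, hx, rfl⟩ := mem_image.1 h
  simp only [closedWalks, mem_filter, mem_univ, true_and] at hx
  refine ⟨?_, ?_⟩
  · intro e he
    obtain ⟨i, -, rfl⟩ := mem_image.1 he
    exact (hx.2 i).1
  · rw [card_image_of_injective _ hx.1, card_univ, Fintype.card_fin]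

/-- This is `1 - 1 / (1 - t) ≤ log (1 - t)`, weakened to a denominator independent of `t`, so that a
product of factors `1 - t` is bounded through the sum of the `t`. -/
theorem exp_neg_div_le_one_sub {t q : ℝ} (ht0 : 0 ≤ t) (htq : t ≤ q) (hq : q < 1) :
    Real.exp (-(t / (1 - q))) ≤ 1 - t := by
  have h1 : 0 < 1 - t := by linarith
  rw [← Real.le_log_iff_exp_le h1]
  refine le_trans ?_ (Real.one_sub_inv_le_log_of_pos h1)
  have h2 : 1 - (1 - t)⁻¹ = -(t / (1 - t)) := by
    field_simp
    ring
  rw [h2]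
  gcongr

/-- The probability that there are `r` unicyclic components. -/
noncomputable def uniProb (U : Finset V) (s : ℕ) (p : ℝ) (r : ℕ) : ℝ :=
  prob (powersetCard (s + 2) U) p fun S => #(unicycles (s + 2) S) = r

theorem exp_le_uniProb_zero (hp0 : 0 ≤ p) (hp1 : p < 1)
    (hx : #U * (#U - 2).choose s * p < 1) :
    Real.exp (-((∑' k : ℕ, (#U * (#U - 2).choose s * p) ^ (k + 2) / (2 * ((k : ℝ) + 2))) /
      (1 - p))) ≤ uniProb U s p 0 := by
  classical
  set x : ℝ := #U * (#U - 2).choose s * p with hxdef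
  set Ω := powersetCard (s + 2) U with hΩ
  -- The edges of a closed walk are distinct, so `k + 2 ≤ #Ω` and finitely many lengths suffice.
  set 𝓑 := (range #Ω).biUnion (closedWalkEdges U s) with h𝓑
  have hx0 : 0 ≤ x := by positivity
  have hsum : Summable fun k : ℕ => x ^ (k + 2) / (2 * ((k : ℝ) + 2)) := by
    refine Summable.of_nonneg_of_le (fun k => by positivity) (fun k => ?_)
      (summable_geometric_of_lt_one hx0 hx)
    refine (div_le_self (by positivity) ?_).trans (pow_le_pow_of_le_one hx0 hx.le (by omega))
    have : (0 : ℝ) ≤ k := k.cast_nonneg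
    linarith
  have h1 : ∑ B ∈ 𝓑, p ^ #B ≤ ∑' k : ℕ, x ^ (k + 2) / (2 * ((k : ℝ) + 2)) := by
    calc ∑ B ∈ 𝓑, p ^ #B = ∑ k ∈ range #Ω, ∑ B ∈ closedWalkEdges U s k, p ^ #B := by
          rw [h𝓑]
          refine sum_biUnion fun k _ k' _ hkk => ?_
          refine Finset.disjoint_left.2 fun B hB hB' => hkk ?_
          have := (mem_closedWalkEdges hB).2
          have := (mem_closedWalkEdges hB').2
          omega
        _ = ∑ k ∈ range #Ω, #(closedWalkEdges U s k) * p ^ (k + 2) := by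
          refine sum_congr rfl fun k _ => ?_
          rw [sum_congr rfl fun B hB => by rw [(mem_closedWalkEdges hB).2], sum_const,
            nsmul_eq_mul]
        _ ≤ ∑ k ∈ range #Ω, x ^ (k + 2) / (2 * ((k : ℝ) + 2)) :=
          sum_le_sum fun k _ => card_closedWalkEdges_le hp0
        _ ≤ _ := hsum.sum_le_tsum _ fun k _ => by positivity
  have h2 : ∀ B ∈ 𝓑, B ⊆ Ω ∧ 1 ≤ #B := by
    intro B hB
    obtain ⟨k, -, hk⟩ := mem_biUnion.1 hB
    have := mem_closedWalkEdges hk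
    exact ⟨this.1, by omega⟩
  have hq : 0 < 1 - p := by linarith
  calc Real.exp (-((∑' k : ℕ, x ^ (k + 2) / (2 * ((k : ℝ) + 2))) / (1 - p)))
      ≤ Real.exp (-((∑ B ∈ 𝓑, p ^ #B) / (1 - p))) := by gcongr
    _ = ∏ B ∈ 𝓑, Real.exp (-(p ^ #B / (1 - p))) := by
      rw [← Real.exp_sum, sum_div, sum_neg_distrib]
    _ ≤ ∏ B ∈ 𝓑, (1 - p ^ #B) := by
      refine prod_le_prod (fun _ _ => (Real.exp_pos _).le) fun B hB => ?_
      exact exp_neg_div_le_one_sub (by positivity)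
        (pow_le_of_le_one hp0 hp1.le (by have := (h2 B hB).2; omega)) hp1
    _ ≤ prob Ω p (fun S => ∀ B ∈ 𝓑, ¬ B ⊆ S) :=
      prod_le_prob_forall_not_subset hp0 hp1.le 𝓑 fun B hB => (h2 B hB).1
    _ ≤ uniProb U s p 0 := by
      refine prob_mono hp0 hp1.le fun S hS h => ?_
      rw [card_eq_zero]
      refine unicycles_eq_empty (fun e he => (mem_powersetCard.1 (hS he)).2) (by omega)
        fun k a b hab => ?_
      have hsub : univ.image b ⊆ S := by
        intro e he
        obtain ⟨i, -, rfl⟩ := mem_image.1 he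
        exact (hab.2 i).1
      refine h (univ.image b) (mem_biUnion.2 ⟨k, ?_, ?_⟩) hsub
      · have h3 := card_le_card (hsub.trans hS)
        rw [card_image_of_injective _ hab.1, card_univ, Fintype.card_fin] at h3
        rw [mem_range]
        omega
      · refine mem_image.2 ⟨(a, b), ?_, rfl⟩
        simp only [closedWalks, mem_filter, mem_univ, true_and]
        exact ⟨hab.1, fun i => ⟨hS (hab.2 i).1, (hab.2 i).2⟩⟩

end Counting

/-! ### Lassos at a given vertex set are rare -/

section LassoBound

variable {V : Type*} [DecidableEq V] {s j : ℕ} {U X : Finset V} {v : V} {p : ℝ}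

/-- The walks with `j` edges from `X`, as pairs of a list of edges and an end vertex. -/
def trails (U X : Finset V) (s : ℕ) : ℕ → Finset (List (Finset V) × V)
  | 0 => X.image fun v => ([], v)
  | j + 1 => (trails U X s j).biUnion fun t => (U.erase t.2).biUnion fun u =>
      {e ∈ powersetCard (s + 2) U | t.2 ∈ e ∧ u ∈ e}.image fun e => (e :: t.1, u)

theorem card_trails_le : #(trails U X s j) ≤ #X * (#U * (#U - 2).choose s) ^ j := by
  induction j with
  | zero => simpa [trails] using card_image_le
  | succ j ih =>
    rw [trails, pow_succ, ← mul_assoc]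
    refine (card_biUnion_le_card_mul _ _ (#U * (#U - 2).choose s) fun t _ => ?_).trans
      (Nat.mul_le_mul_right _ ih)
    refine (card_biUnion_le_card_mul _ _ ((#U - 2).choose s) fun u hu => ?_).trans
      (Nat.mul_le_mul_right _ (card_le_card (erase_subset _ _)))
    exact card_image_le.trans (card_edges_pair_le (mem_erase.1 hu).1.symm)

theorem mem_of_mem_trails {t : List (Finset V) × V} (h : t ∈ trails U X s j) :
    t.1.length = j ∧ ∀ e ∈ t.1, e ∈ powersetCard (s + 2) U := by
  induction j generalizing t with
  | zero =>
    obtain ⟨v, -, rfl⟩ := mem_image.1 h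
    simp
  | succ j ih =>
    rw [trails] at h
    obtain ⟨t', ht', h⟩ := mem_biUnion.1 h
    obtain ⟨u, -, h⟩ := mem_biUnion.1 h
    obtain ⟨e, he, rfl⟩ := mem_image.1 h
    obtain ⟨h1, h2⟩ := ih ht'
    refine ⟨by simp [h1], fun f hf => ?_⟩
    rcases List.mem_cons.1 hf with rfl | hf
    · exact (mem_filter.1 he).1
    · exact h2 f hf

theorem Trail.mem_trails {l : List (Finset V)} (h : Trail (powersetCard (s + 2) U) X l v) :
    (l, v) ∈ trails U X s l.length := by
  induction h with
  | nil h => exact mem_image_of_mem _ h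
  | @cons l v u e _ he h1 h2 h3 ih =>
    rw [List.length_cons, trails]
    refine mem_biUnion.2 ⟨_, ih, mem_biUnion.2 ⟨u, mem_erase.2 ⟨h3, ?_⟩, mem_image.2 ⟨e, ?_, rfl⟩⟩⟩
    · exact (mem_powersetCard.1 he).1 h2
    · exact mem_filter.2 ⟨he, h1, h2⟩

/-- The edge lists, with `j + 1` members, of the walks from `X` whose last edge closes a cycle. -/
def lassos (U X : Finset V) (s j : ℕ) : Finset (List (Finset V)) :=
  (trails U X s j).biUnion fun t => ((X ∪ t.1.toFinset.biUnion id).erase t.2).biUnion fun w =>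
    {e ∈ powersetCard (s + 2) U | t.2 ∈ e ∧ w ∈ e}.image fun e => e :: t.1

/-- The last edge returns to one of at most `#X + j * (s + 2)` vertices already used, where an open
walk could go to any of `#U`. This saving is the factor `1 / N` in `lassoBound`. -/
theorem card_lassos_le : #(lassos U X s j) ≤
    #X * (#U * (#U - 2).choose s) ^ j * ((#X + j * (s + 2)) * (#U - 2).choose s) := by
  refine (card_biUnion_le_card_mul _ _ ((#X + j * (s + 2)) * (#U - 2).choose s)
    fun t ht => ?_).trans (Nat.mul_le_mul_right _ card_trails_le)
  obtain ⟨h1, h2⟩ := mem_of_mem_trails ht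
  refine (card_biUnion_le_card_mul _ _ ((#U - 2).choose s) fun u hu => ?_).trans
    (Nat.mul_le_mul_right _ ?_)
  · exact card_image_le.trans (card_edges_pair_le (mem_erase.1 hu).1.symm)
  · refine (card_le_card (erase_subset _ _)).trans ((card_union_le _ _).trans ?_)
    gcongr
    refine (card_biUnion_le_card_mul _ _ (s + 2) fun e he => ?_).trans
      (Nat.mul_le_mul_right _ (h1 ▸ List.toFinset_card_le t.1))
    exact (mem_powersetCard.1 (h2 e (List.mem_toFinset.1 he))).2.le

theorem Lasso.exists_mem_lassos {S : Finset (Finset V)} (hS : S ⊆ powersetCard (s + 2) U)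
    (h : Lasso S X) : ∃ j < #(powersetCard (s + 2) U), ∃ L ∈ lassos U X s j,
      L.Nodup ∧ L.length = j + 1 ∧ L.toFinset ⊆ S := by
  obtain ⟨l, v, e, w, h1, h2, h3, h4, h5, h6, h7⟩ := h
  have hsub : (e :: l).toFinset ⊆ S := by
    intro f hf
    rcases List.mem_cons.1 (List.mem_toFinset.1 hf) with rfl | hf
    · exact h3
    · exact h1.mem_of_mem f hf
  refine ⟨l.length, ?_, e :: l, ?_, h2, rfl, hsub⟩
  · have := card_le_card (hsub.trans hS)
    rw [List.toFinset_card_of_nodup h2, List.length_cons] at this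
    omega
  · refine mem_biUnion.2 ⟨(l, v), (h1.mono hS Subset.rfl).mem_trails,
      mem_biUnion.2 ⟨w, mem_erase.2 ⟨h6, ?_⟩,
        mem_image_of_mem _ (mem_filter.2 ⟨hS h3, h4, h5⟩)⟩⟩
    rw [mem_union]
    refine h7.imp_right fun ⟨f, hf, hw⟩ => mem_biUnion.2 ⟨f, List.mem_toFinset.2 hf, hw⟩

/-- A bound for the probability that a lasso starts at one of `m` vertices. -/
noncomputable def lassoBound (N s : ℕ) (p : ℝ) (m : ℕ) : ℝ :=
  (∑' j : ℕ, (m * (m + j * (s + 2)) : ℝ) * (N * (N - 2).choose s * p) ^ (j + 1)) / N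

theorem summable_lassoBound {x : ℝ} (hx0 : 0 ≤ x) (hx1 : x < 1) (m s : ℕ) :
    Summable fun j : ℕ => (m * (m + j * (s + 2)) : ℝ) * x ^ (j + 1) := by
  have hx : ‖x‖ < 1 := by rwa [Real.norm_of_nonneg hx0]
  have h1 := (summable_geometric_of_lt_one hx0 hx1).mul_left ((m : ℝ) * m * x)
  have h2 := (summable_pow_mul_geometric_of_norm_lt_one 1 hx).mul_left ((m : ℝ) * (s + 2) * x)
  refine (h1.add h2).congr fun j => ?_
  ring

theorem prob_lasso_le [Fintype V] (hp0 : 0 ≤ p) (hp1 : p ≤ 1) (hU : 0 < #U)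
    (hx : #U * (#U - 2).choose s * p < 1) :
    prob (powersetCard (s + 2) U) p (fun S => Lasso S X) ≤ lassoBound #U s p #X := by
  classical
  set Ω := powersetCard (s + 2) U with hΩ
  set x : ℝ := #U * (#U - 2).choose s * p with hxdef
  have hx0 : 0 ≤ x := by positivity
  have hU' : (0 : ℝ) < #U := by exact_mod_cast hU
  let I : ℕ → Finset (List (Finset V)) := fun j =>
    {L ∈ lassos U X s j | L.Nodup ∧ L.length = j + 1 ∧ L.toFinset ⊆ Ω}
  have hterm : ∀ j, ∑ L ∈ I j, prob Ω p (fun S => L.toFinset ⊆ S) ≤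
      (#X * (#X + j * (s + 2)) : ℝ) * x ^ (j + 1) / #U := by
    intro j
    have h1 : ∀ L ∈ I j, prob Ω p (fun S => L.toFinset ⊆ S) = p ^ (j + 1) := by
      intro L hL
      obtain ⟨-, h2, h3, h4⟩ := mem_filter.1 hL
      rw [prob_superset h4, List.toFinset_card_of_nodup h2, h3]
    rw [sum_congr rfl h1, sum_const, nsmul_eq_mul]
    have h2 : (#(I j) : ℝ) ≤ #X * (#U * ((#U - 2).choose s : ℕ)) ^ j *
        ((#X + j * (s + 2)) * ((#U - 2).choose s : ℕ)) := by
      exact_mod_cast (card_le_card (filter_subset _ _)).trans card_lassos_le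
    refine (mul_le_mul_of_nonneg_right h2 (pow_nonneg hp0 _)).trans_eq ?_
    rw [eq_div_iff hU'.ne', hxdef]
    ring
  calc prob Ω p (fun S => Lasso S X)
      ≤ prob Ω p (fun S => ∃ j ∈ range #Ω, ∃ L ∈ I j, L.toFinset ⊆ S) := by
        refine prob_mono hp0 hp1 fun S hS h => ?_
        obtain ⟨j, hj, L, hL, h1, h2, h3⟩ := h.exists_mem_lassos hS
        exact ⟨j, mem_range.2 hj, L, mem_filter.2 ⟨hL, h1, h2, h3.trans hS⟩, h3⟩
    _ ≤ ∑ j ∈ range #Ω, prob Ω p (fun S => ∃ L ∈ I j, L.toFinset ⊆ S) :=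
        prob_exists_le hp0 hp1 _ _
    _ ≤ ∑ j ∈ range #Ω, (#X * (#X + j * (s + 2)) : ℝ) * x ^ (j + 1) / #U :=
        sum_le_sum fun j _ => (prob_exists_le hp0 hp1 _ _).trans (hterm j)
    _ ≤ lassoBound #U s p #X := by
        rw [← sum_div, lassoBound]
        gcongr
        exact (summable_lassoBound hx0 hx _ _).sum_le_tsum _ fun j _ => by positivity

end LassoBound

/-! ### Planting a loose cycle: the recursion in the number of unicyclic components -/

section Recursion

variable {V : Type*} {s : ℕ} {U : Finset V} {p : ℝ}

theorem cycleEdges_subset_powersetCard [DecidableEq V] {k : ℕ} {g : CycleIndex s k ↪ V} (h : ∀ x, g x ∈ U) :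
    cycleEdges g ⊆ powersetCard (s + 2) U := by
  intro e he
  obtain ⟨i, rfl⟩ := mem_cycleEdges.1 he
  refine mem_powersetCard.2 ⟨fun w hw => ?_, card_cycleEdge⟩
  rcases mem_cycleEdge.1 hw with rfl | rfl | ⟨a, rfl⟩ <;> exact h _

variable [Fintype V]

theorem uniProb_nonneg (hp0 : 0 ≤ p) (hp1 : p ≤ 1) (r : ℕ) : 0 ≤ uniProb U s p r :=
  prob_nonneg hp0 hp1

theorem uniProb_le_one (hp0 : 0 ≤ p) (hp1 : p ≤ 1) (r : ℕ) : uniProb U s p r ≤ 1 :=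
  prob_le_one hp0 hp1

theorem sum_uniProb_le_one (hp0 : 0 ≤ p) (hp1 : p ≤ 1) (R : ℕ) :
    ∑ r ∈ range R, uniProb U s p r ≤ 1 := by
  have h := sum_prob_le (Ω := powersetCard (s + 2) U) (A := fun _ => True) hp0 hp1 (range R)
    (fun r S => #(unicycles (s + 2) S) = r) 1 (fun _ _ _ _ _ => trivial)
    (fun S _ _ J _ hJ => card_le_one.2 fun a ha b hb => (hJ a ha).symm.trans (hJ b hb))
  rwa [prob_true, Nat.cast_one, mul_one] at h

variable [DecidableEq V]

/-- The event that a loose cycle `C` is present and that its vertices are the roots of a forest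
in the remaining hypergraph, which has `r` unicyclic components, has at least the probability
that is expected from independence. -/
theorem le_prob_cycle {k : ℕ} (hs : 1 ≤ s) (hp0 : 0 ≤ p) (hp1 : p ≤ 1) (hU : 0 < #U)
    (hx : #U * (#U - 2).choose s * p < 1) (r : ℕ) {C : Finset (Finset V)}
    (hC : C ∈ looseCycles U s k) :
    p ^ (k + 2) * (uniProb U s p r - (lassoBound #U s p ((k + 2) * (s + 1)) + (k + 2) * p)) ≤
      prob (powersetCard (s + 2) U) p (fun S => C ⊆ S ∧
        (#(unicycles (s + 2) (S \ C)) = r ∧ ¬ Lasso (S \ C) (C.biUnion id))) := by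
  obtain ⟨g, rfl, hgU⟩ := exists_of_mem_looseCycles hC
  have hCΩ := cycleEdges_subset_powersetCard hgU
  have h1 := prob_superset_and_sdiff (A := fun S => #(unicycles (s + 2) S) = r ∧
    ¬ Lasso S ((cycleEdges g).biUnion id)) hp0 hp1 hCΩ
  rw [card_cycleEdges hs] at h1
  refine le_trans (mul_le_mul_of_nonneg_left ?_ (pow_nonneg hp0 _)) h1
  rw [sub_le_iff_le_add]
  have h2 : prob (powersetCard (s + 2) U) p (fun S => ∃ e ∈ cycleEdges g, {e} ⊆ S) ≤
      (k + 2) * p := by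
    refine (prob_exists_le hp0 hp1 _ _).trans_eq ?_
    rw [sum_congr rfl fun e he => prob_superset (singleton_subset_iff.2 (hCΩ he))]
    simp [card_cycleEdges hs]
  have h3 := prob_lasso_le (X := (cycleEdges g).biUnion id) hp0 hp1 hU hx
  rw [card_biUnion_cycleEdges] at h3
  -- The conditions that no lasso starts at the cycle and that none of its edges is present are
  -- dropped, at the price of the probabilities that they fail.
  refine le_trans ?_ (add_le_add le_rfl (add_le_add h3 h2))
  refine le_trans ?_ (add_le_add le_rfl (prob_or_le hp0 hp1))
  refine le_trans ?_ (prob_or_le hp0 hp1)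
  refine prob_mono hp0 hp1 fun S _ hS => ?_
  by_cases hl : Lasso S ((cycleEdges g).biUnion id)
  · exact Or.inr (Or.inl hl)
  · by_cases hd : Disjoint S (cycleEdges g)
    · exact Or.inl ⟨⟨hS, hl⟩, hd⟩
    · obtain ⟨e, he, he'⟩ := Finset.not_disjoint_iff.1 hd
      exact Or.inr (Or.inr ⟨e, he', singleton_subset_iff.2 he⟩)

/-- The planted events are counted in two ways. Each one forces `r + 1` unicyclic components, and at
most `r + 1` of them hold together because such a component contains only one loose cycle. The
division by `2 * (k + 2) * s.factorial ^ (k + 2)` passes from labelled cycles to edge sets. -/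
theorem sum_le_uniProb_succ (hs : 1 ≤ s) (hp0 : 0 ≤ p) (hp1 : p ≤ 1) (hU : 0 < #U)
    (hx : #U * (#U - 2).choose s * p < 1) (r K : ℕ) :
    ∑ k ∈ range K, (#U).descFactorial ((k + 2) * (s + 1)) * p ^ (k + 2) /
      (2 * (k + 2) * s.factorial ^ (k + 2)) *
      (uniProb U s p r - (lassoBound #U s p ((k + 2) * (s + 1)) + (k + 2) * p)) ≤
      (r + 1) * uniProb U s p (r + 1) := by
  classical
  set P : Finset (Finset V) → Finset (Finset V) → Prop := fun C S => C ⊆ S ∧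
    (#(unicycles (s + 2) (S \ C)) = r ∧ ¬ Lasso (S \ C) (C.biUnion id)) with hP
  have hkey : ∀ S ⊆ powersetCard (s + 2) U, ∀ k, ∀ C ∈ looseCycles U s k, P C S →
      ∃ g : CycleIndex s k ↪ V, cycleEdges g = C ∧ Unicyclic (s + 2) S (g (.inl 0)) ∧
        #(unicycles (s + 2) S) = r + 1 := by
    rintro S hS k C hC ⟨hCS, hr, hl⟩
    obtain ⟨g, rfl, -⟩ := exists_of_mem_looseCycles hC
    have h := unicyclic_union_cycleEdges hs
      (fun e he => (mem_powersetCard.1 (hS (sdiff_subset he))).2) sdiff_disjoint hl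
    rw [sdiff_union_of_subset hCS, hr] at h
    exact ⟨g, rfl, h⟩
  have h1 : ∑ C ∈ (range K).biUnion (looseCycles U s), prob (powersetCard (s + 2) U) p (P C) ≤
      ((r + 1 : ℕ) : ℝ) * uniProb U s p (r + 1) := by
    refine sum_prob_le hp0 hp1 _ _ (r + 1) (fun S hS C hC hPC => ?_) fun S hS hr J hJ hPJ => ?_
    · obtain ⟨k, -, hC⟩ := mem_biUnion.1 hC
      obtain ⟨g, -, -, h⟩ := hkey S hS k C hC hPC
      exact h
    · rw [← hr]
      have hJ' : ∀ C ∈ J, ∃ k, ∃ g : CycleIndex s k ↪ V, cycleEdges g = C ∧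
          Unicyclic (s + 2) S (g (.inl 0)) ∧ C ⊆ S := by
        intro C hC
        obtain ⟨k, -, hCk⟩ := mem_biUnion.1 (hJ hC)
        obtain ⟨g, h1, h2, -⟩ := hkey S hS k C hCk (hPJ C hC)
        exact ⟨k, g, h1, h2, (hPJ C hC).1⟩
      -- Each cycle is sent to the vertex set of its component.
      refine card_le_card_of_injOn (fun C => if h : C ∈ J then
        reach {(hJ' C h).choose_spec.choose (.inl 0)} S else ∅) ?_ ?_
      · intro C hC
        have hC' : C ∈ J := hC
        simp only [hC', dif_pos]
        exact mem_unicycles.2 ⟨_, (hJ' C hC').choose_spec.choose_spec.2.1, rfl⟩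
      · intro C hC C' hC' hCC
        have h1 : C ∈ J := hC
        have h2 : C' ∈ J := hC'
        simp only [h1, h2, dif_pos] at hCC
        obtain ⟨g1, g2, g3⟩ := (hJ' C h1).choose_spec.choose_spec
        obtain ⟨g1', g2', g3'⟩ := (hJ' C' h2).choose_spec.choose_spec
        set g := (hJ' C h1).choose_spec.choose
        set g' := (hJ' C' h2).choose_spec.choose
        have hunif : ∀ e ∈ S, #e = s + 2 := fun e he => (mem_powersetCard.1 (hS he)).2
        have m1 : g (.inl 0) ∈ reach {g (.inl 0)} S := subset_reach (mem_singleton_self _)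
        have m2 : g' (.inl 0) ∈ reach {g (.inl 0)} S :=
          hCC ▸ subset_reach (mem_singleton_self _)
        have m3 : g' (.inl 0) ∈ reach {g' (.inl 0)} S := subset_reach (mem_singleton_self _)
        have m4 : g (.inl 0) ∈ reach {g' (.inl 0)} S := hCC ▸ m1
        rw [← g1, ← g1']
        exact (cycleEdges_subset_of_unicyclic hs hunif (g1'.symm ▸ g3') (g1.symm ▸ g3) g2' m3
          m4).antisymm (cycleEdges_subset_of_unicyclic hs hunif (g1.symm ▸ g3) (g1'.symm ▸ g3')
            g2 m1 m2)
  rw [Nat.cast_add, Nat.cast_one] at h1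
  refine le_trans ?_ h1
  rw [sum_biUnion]
  · refine sum_le_sum fun k _ => ?_
    -- The bound for the number of cycles is a lower bound, so it may be multiplied only by a
    -- nonnegative bracket; a negative bracket makes the claim trivial.
    rcases le_total (uniProb U s p r - (lassoBound #U s p ((k + 2) * (s + 1)) + (k + 2) * p)) 0
      with hneg | hpos
    · exact (mul_nonpos_of_nonneg_of_nonpos (by positivity) hneg).trans
        (sum_nonneg fun C _ => prob_nonneg hp0 hp1)
    · have h2 := card_nsmul_le_sum (looseCycles U s k)
        (fun C => prob (powersetCard (s + 2) U) p (P C)) _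
        fun C hC => le_prob_cycle hs hp0 hp1 hU hx r hC
      refine le_trans ?_ h2
      rw [nsmul_eq_mul, ← mul_assoc]
      refine mul_le_mul_of_nonneg_right ?_ hpos
      rw [div_le_iff₀ (by positivity), mul_right_comm]
      refine mul_le_mul_of_nonneg_right ?_ (pow_nonneg hp0 _)
      exact_mod_cast (descFactorial_le_card_looseCycles (k := k) hs U).trans_eq (mul_comm _ _)
  · intro k _ k' _ hkk
    refine Finset.disjoint_left.2 fun C hC hC' => hkk ?_
    obtain ⟨g, hg, -⟩ := exists_of_mem_looseCycles hC
    obtain ⟨g', hg', -⟩ := exists_of_mem_looseCycles hC'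
    have h2 := card_cycleEdges hs (g := g)
    have h3 := card_cycleEdges hs (g := g')
    rw [hg] at h2
    rw [hg'] at h3
    omega

end Recursion

/-! ### Asymptotics and the limit probability of no unicyclic component -/

section Limits

/-- The sum `∑ x ^ k / (2 k)` over `k ≥ 2`. -/
noncomputable def cycleSeries (x : ℝ) : ℝ := ∑' k : ℕ, x ^ (k + 2) / (2 * ((k : ℝ) + 2))

theorem hasSum_cycleSeries {x : ℝ} (hx0 : 0 < x) (hx1 : x < 1) :
    HasSum (fun k : ℕ => x ^ (k + 2) / (2 * ((k : ℝ) + 2)))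
      (1 / 2 * Real.log (1 / (1 - x)) - x / 2) := by
  simpa using Hypergraph.hasSum_cycleSum 2 x hx0 (by simpa using hx1)

/-- The lower bound for finite `N` contains the series at an argument that only tends to `c / s!`.
-/
theorem continuousAt_cycleSeries {x : ℝ} (hx0 : 0 < x) (hx1 : x < 1) :
    ContinuousAt cycleSeries x := by
  have h : ContinuousAt (fun y : ℝ => 1 / 2 * Real.log (1 / (1 - y)) - y / 2) x := by
    have h1 : 1 - x ≠ 0 := by linarith
    have h2 : 1 / (1 - x) ≠ 0 := one_div_ne_zero h1
    fun_prop (disch := assumption)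
  refine h.congr ?_
  filter_upwards [Ioo_mem_nhds hx0 hx1] with y hy
  exact (hasSum_cycleSeries hy.1 hy.2).tsum_eq.symm

theorem tendsto_descFactorial_div_pow (m : ℕ) :
    Tendsto (fun N : ℕ => (N.descFactorial m : ℝ) / (N : ℝ) ^ m) atTop (𝓝 1) := by
  refine (isEquivalent_iff_tendsto_one ?_).1 (isEquivalent_descFactorial m)
  filter_upwards [eventually_gt_atTop 0] with N hN
  positivity

theorem tendsto_choose_div_pow (a s : ℕ) :
    Tendsto (fun N : ℕ => ((N - a).choose s : ℝ) / (N : ℝ) ^ s) atTop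
      (𝓝 (1 / (s.factorial : ℝ))) := by
  rw [← tendsto_add_atTop_iff_nat a]
  have h1 := (tendsto_descFactorial_div_pow s).div_const (s.factorial : ℝ)
  have h2 : Tendsto (fun N : ℕ => (N : ℝ) / ((N : ℝ) + (a : ℕ))) atTop (𝓝 1) :=
    tendsto_natCast_div_add_atTop _
  have h3 := h1.mul (h2.pow s)
  rw [one_pow, mul_one] at h3
  refine h3.congr' ?_
  filter_upwards [eventually_gt_atTop 0] with N hN
  have hN' : (0 : ℝ) < N := by exact_mod_cast hN
  rw [Nat.add_sub_cancel, Nat.descFactorial_eq_factorial_mul_choose]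
  push_cast
  rw [div_pow]
  field_simp

/-- For a fixed `ρ` between `x` and `1`, the series is eventually dominated by its value at `ρ`, and
the remaining factor `1 / N` tends to zero. -/
theorem tendsto_lassoBound {N : ℕ → ℕ} {p : ℕ → ℝ} {s : ℕ} {x : ℝ} (m : ℕ)
    (hN : Tendsto N atTop atTop) (hp : ∀ n, 0 ≤ p n)
    (hx : Tendsto (fun n => (N n : ℝ) * (N n - 2).choose s * p n) atTop (𝓝 x)) (hx1 : x < 1) :
    Tendsto (fun n => lassoBound (N n) s (p n) m) atTop (𝓝 0) := by
  obtain ⟨ρ, hρ, hρ1⟩ := exists_between hx1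
  have hx0 : ∀ n, 0 ≤ (N n : ℝ) * (N n - 2).choose s * p n := fun n =>
    mul_nonneg (by positivity) (hp n)
  have hρ0 : 0 ≤ ρ := (ge_of_tendsto' hx hx0).trans hρ.le
  have hN' : Tendsto (fun n => (N n : ℝ)) atTop atTop := tendsto_natCast_atTop_atTop.comp hN
  refine squeeze_zero' (Eventually.of_forall fun n => ?_) ?_
    (hN'.const_div_atTop (∑' j : ℕ, (m * (m + j * (s + 2)) : ℝ) * ρ ^ (j + 1)))
  · exact div_nonneg (tsum_nonneg fun j => mul_nonneg (by positivity)
      (pow_nonneg (hx0 n) _)) (Nat.cast_nonneg _)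
  · filter_upwards [hx.eventually_lt_const hρ] with n hn
    rw [lassoBound]
    gcongr
    · exact summable_lassoBound (hx0 n) (hn.trans hρ1) m s
    · exact summable_lassoBound hρ0 hρ1 m s
    · exact hx0 n

variable {V : ℕ → Type*} {U : ∀ n, Finset (V n)} {p : ℕ → ℝ} {s : ℕ} {c : ℝ}

theorem tendsto_edge_prob (hN : Tendsto (fun n => #(U n)) atTop atTop)
    (hc : Tendsto (fun n => (#(U n) : ℝ) ^ (s + 1) * p n) atTop (𝓝 c)) :
    Tendsto p atTop (𝓝 0) := by
  have hN' : Tendsto (fun n => (#(U n) : ℝ)) atTop atTop := tendsto_natCast_atTop_atTop.comp hN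
  refine (hc.div_atTop ((tendsto_pow_atTop (Nat.succ_ne_zero s)).comp hN')).congr' ?_
  filter_upwards [hN'.eventually_gt_atTop 0] with n hn
  simp only [Function.comp]
  field_simp

theorem tendsto_mean_degree (hN : Tendsto (fun n => #(U n)) atTop atTop)
    (hc : Tendsto (fun n => (#(U n) : ℝ) ^ (s + 1) * p n) atTop (𝓝 c)) :
    Tendsto (fun n => (#(U n) : ℝ) * (#(U n) - 2).choose s * p n) atTop
      (𝓝 (c / s.factorial)) := by
  have hN' : Tendsto (fun n => (#(U n) : ℝ)) atTop atTop := tendsto_natCast_atTop_atTop.comp hN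
  have h := ((tendsto_choose_div_pow 2 s).comp hN).mul hc
  rw [one_div_mul_eq_div] at h
  refine h.congr' ?_
  filter_upwards [hN'.eventually_gt_atTop 0] with n hn
  simp only [Function.comp]
  rw [pow_succ]
  field_simp

theorem tendsto_mean_cycles (k : ℕ) (hN : Tendsto (fun n => #(U n)) atTop atTop)
    (hc : Tendsto (fun n => (#(U n) : ℝ) ^ (s + 1) * p n) atTop (𝓝 c)) :
    Tendsto (fun n => ((#(U n)).descFactorial ((k + 2) * (s + 1)) : ℝ) * p n ^ (k + 2) /
      (2 * (k + 2) * s.factorial ^ (k + 2))) atTop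
      (𝓝 ((c / s.factorial) ^ (k + 2) / (2 * ((k : ℝ) + 2)))) := by
  have hN' : Tendsto (fun n => (#(U n) : ℝ)) atTop atTop := tendsto_natCast_atTop_atTop.comp hN
  have h := (((tendsto_descFactorial_div_pow ((k + 2) * (s + 1))).comp hN).mul
    (hc.pow (k + 2))).div_const (2 * ((k : ℝ) + 2) * (s.factorial : ℝ) ^ (k + 2))
  have e : 1 * c ^ (k + 2) / (2 * ((k : ℝ) + 2) * (s.factorial : ℝ) ^ (k + 2)) =
      (c / s.factorial) ^ (k + 2) / (2 * ((k : ℝ) + 2)) := by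
    rw [div_pow, one_mul, div_div, mul_comm]
  rw [e] at h
  refine h.congr' ?_
  filter_upwards [hN'.eventually_gt_atTop 0] with n hn
  simp only [Function.comp]
  rw [mul_pow, ← pow_mul, mul_comm (s + 1) (k + 2)]
  field_simp

variable [∀ n, Fintype (V n)] [∀ n, DecidableEq (V n)]

/-- The number of unicyclic components is asymptotically at least Poisson distributed, up to
normalization. -/
theorem exists_le_uniProb (hs : 1 ≤ s) (hc0 : 0 < c) (hcs : c < s.factorial)
    (hp0 : ∀ n, 0 ≤ p n) (hp1 : ∀ n, p n ≤ 1) (hN : Tendsto (fun n => #(U n)) atTop atTop)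
    (hc : Tendsto (fun n => (#(U n) : ℝ) ^ (s + 1) * p n) atTop (𝓝 c)) (K r : ℕ) :
    ∃ η : ℕ → ℝ, Tendsto η atTop (𝓝 0) ∧ ∀ᶠ n in atTop, uniProb (U n) s (p n) 0 *
      ((∑ k ∈ range K, (c / s.factorial) ^ (k + 2) / (2 * ((k : ℝ) + 2))) ^ r / r.factorial) -
        η n ≤ uniProb (U n) s (p n) r := by
  have hs0 : (0 : ℝ) < s.factorial := by positivity
  have hx1 : c / s.factorial < 1 := (div_lt_one hs0).2 hcs
  have hx0 : 0 < c / s.factorial := by positivity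
  set x := c / s.factorial
  set F := ∑ k ∈ range K, x ^ (k + 2) / (2 * ((k : ℝ) + 2)) with hF
  have hF0 : 0 ≤ F := sum_nonneg fun k _ => by positivity
  set m : ℕ → ℕ → ℝ := fun n k => ((#(U n)).descFactorial ((k + 2) * (s + 1)) : ℝ) *
    p n ^ (k + 2) / (2 * (k + 2) * s.factorial ^ (k + 2)) with hm
  set β : ℕ → ℕ → ℝ := fun n k =>
    lassoBound #(U n) s (p n) ((k + 2) * (s + 1)) + (k + 2) * p n with hβ
  have hm0 : ∀ n k, 0 ≤ m n k := fun n k => by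
    have := hp0 n
    positivity
  have hp := tendsto_edge_prob hN hc
  have hx := tendsto_mean_degree hN hc
  have hmlim : ∀ k, Tendsto (fun n => m n k) atTop (𝓝 (x ^ (k + 2) / (2 * ((k : ℝ) + 2)))) :=
    fun k => tendsto_mean_cycles k hN hc
  have hβlim : ∀ k, Tendsto (fun n => β n k) atTop (𝓝 0) := fun k => by
    simpa using (tendsto_lassoBound ((k + 2) * (s + 1)) hN hp0 hx hx1).add
      (hp.const_mul ((k : ℝ) + 2))
  have hM : Tendsto (fun n => ∑ k ∈ range K, m n k) atTop (𝓝 F) :=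
    tendsto_finsetSum _ fun k _ => hmlim k
  have hMβ : Tendsto (fun n => ∑ k ∈ range K, m n k * β n k) atTop (𝓝 0) := by
    simpa using tendsto_finsetSum (range K) fun k _ => (hmlim k).mul (hβlim k)
  induction r with
  | zero => exact ⟨fun _ => 0, tendsto_const_nhds, Eventually.of_forall fun n => by simp⟩
  | succ r ih =>
    obtain ⟨η, hη, hle⟩ := ih
    set G := F ^ r / r.factorial with hG
    have hG0 : 0 ≤ G := by positivity
    -- The three error terms come from replacing the mean `∑ m n k` by its limit `F`, from the
    -- previous error `η`, and from the loss `β` in planting a cycle.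
    refine ⟨fun n => (|∑ k ∈ range K, m n k - F| * G + (∑ k ∈ range K, m n k) * η n +
      ∑ k ∈ range K, m n k * β n k) / (r + 1), ?_, ?_⟩
    · have h := ((((hM.sub_const F).abs.mul_const G).add (hM.mul hη)).add hMβ).div_const
        ((r : ℝ) + 1)
      simpa using h
    · filter_upwards [hle, hx.eventually_lt_const hx1, hN.eventually_gt_atTop 0] with n hn hxn hUn
      have h := sum_le_uniProb_succ hs (hp0 n) (hp1 n) hUn hxn r K
      have h' : (∑ k ∈ range K, m n k) * uniProb (U n) s (p n) r -
          ∑ k ∈ range K, m n k * β n k ≤ (r + 1) * uniProb (U n) s (p n) (r + 1) := by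
        refine le_trans (le_of_eq ?_) h
        rw [sum_mul, ← sum_sub_distrib]
        exact sum_congr rfl fun k _ => (mul_sub _ _ _).symm
      set q := uniProb (U n) s (p n) 0
      have hq0 : 0 ≤ q := uniProb_nonneg (hp0 n) (hp1 n) 0
      have hq1 : q ≤ 1 := uniProb_le_one (hp0 n) (hp1 n) 0
      set M := ∑ k ∈ range K, m n k
      have hM0 : 0 ≤ M := sum_nonneg fun k _ => hm0 n k
      have h1 := mul_le_mul_of_nonneg_left hn hM0
      have h2 : -(|M - F| * G) ≤ (M - F) * (q * G) := by
        have h3 : |(M - F) * (q * G)| ≤ |M - F| * G := by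
          rw [abs_mul, abs_of_nonneg (mul_nonneg hq0 hG0)]
          exact mul_le_mul_of_nonneg_left (mul_le_of_le_one_left hG0 hq1) (abs_nonneg _)
        exact (abs_le.1 h3).1 |>.trans' (by linarith)
      have hGsucc : F ^ (r + 1) / ((r + 1).factorial : ℝ) = F * G / (r + 1) := by
        rw [hG, Nat.factorial_succ]
        push_cast
        rw [pow_succ]
        field_simp
      have hr : (0 : ℝ) < r + 1 := by positivity
      rw [hGsucc, ← mul_div_assoc, ← sub_div, div_le_iff₀ hr]
      linarith

/-- The limit of the probability that there is no unicyclic component. -/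
theorem tendsto_uniProb_zero (hs : 1 ≤ s) (hc0 : 0 < c) (hcs : c < s.factorial)
    (hp0 : ∀ n, 0 ≤ p n) (hp1 : ∀ n, p n ≤ 1) (hN : Tendsto (fun n => #(U n)) atTop atTop)
    (hc : Tendsto (fun n => (#(U n) : ℝ) ^ (s + 1) * p n) atTop (𝓝 c)) :
    Tendsto (fun n => uniProb (U n) s (p n) 0) atTop
      (𝓝 (Real.exp (-cycleSeries (c / s.factorial)))) := by
  have hs0 : (0 : ℝ) < s.factorial := by positivity
  have hx1 : c / s.factorial < 1 := (div_lt_one hs0).2 hcs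
  have hx0 : 0 < c / s.factorial := by positivity
  have hp := tendsto_edge_prob hN hc
  have hx := tendsto_mean_degree hN hc
  set x := c / s.factorial
  refine tendsto_order.2 ⟨fun a ha => ?_, fun b hb => ?_⟩
  · have h1 : Tendsto (fun n => Real.exp (-(cycleSeries (#(U n) * (#(U n) - 2).choose s * p n) /
        (1 - p n)))) atTop (𝓝 (Real.exp (-(cycleSeries x / (1 - 0))))) :=
      (Real.continuous_exp.tendsto _).comp ((((continuousAt_cycleSeries hx0 hx1).tendsto.comp
        hx).div (tendsto_const_nhds.sub hp) (by norm_num)).neg)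
    rw [sub_zero, div_one] at h1
    filter_upwards [h1.eventually_const_lt ha, hx.eventually_lt_const hx1,
      hp.eventually_lt_const one_pos] with n hn hxn hpn
    exact hn.trans_le (exp_le_uniProb_zero (hp0 n) hpn hxn)
  -- The cutoffs are chosen before `n`: first `K` with `exp (-F) < b`, then `R` such that the
  -- reciprocal of the truncated exponential series is still below `b`.
  · have hF : Tendsto (fun K => Real.exp (-∑ k ∈ range K, x ^ (k + 2) / (2 * ((k : ℝ) + 2)))) atTop
        (𝓝 (Real.exp (-cycleSeries x))) :=
      (Real.continuous_exp.tendsto _).comp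
        (hasSum_cycleSeries hx0 hx1).summable.hasSum.tendsto_sum_nat.neg
    obtain ⟨K, hK⟩ := (hF.eventually_lt_const hb).exists
    set F := ∑ k ∈ range K, x ^ (k + 2) / (2 * ((k : ℝ) + 2)) with hFdef
    have hF0 : 0 ≤ F := sum_nonneg fun k _ => by positivity
    have hT : Tendsto (fun R => (∑ r ∈ range R, F ^ r / r.factorial)⁻¹) atTop
        (𝓝 (Real.exp (-F))) := by
      rw [Real.exp_neg, Real.exp_eq_exp_ℝ]
      exact (NormedSpace.expSeries_div_hasSum_exp F).tendsto_sum_nat.inv₀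
        (by rw [← Real.exp_eq_exp_ℝ]; exact (Real.exp_pos _).ne')
    obtain ⟨R, hR, hR0⟩ := ((hT.eventually_lt_const hK).and (eventually_gt_atTop 0)).exists
    set T := ∑ r ∈ range R, F ^ r / r.factorial with hTdef
    have hT0 : 0 < T := by
      refine sum_pos' (fun r _ => by positivity) ⟨0, mem_range.2 hR0, by simp⟩
    choose η hη hle using fun r => exists_le_uniProb hs hc0 hcs hp0 hp1 hN hc K r
    have hηsum : Tendsto (fun n => (1 + ∑ r ∈ range R, η r n) * T⁻¹) atTop (𝓝 T⁻¹) := by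
      simpa using ((tendsto_finsetSum (range R) fun r _ => hη r).const_add 1).mul_const T⁻¹
    have hall : ∀ᶠ n in atTop, ∀ r ∈ range R, uniProb (U n) s (p n) 0 * (F ^ r / r.factorial) -
        η r n ≤ uniProb (U n) s (p n) r :=
      (eventually_all_finset _).2 fun r _ => hle r
    filter_upwards [hall, hηsum.eventually_lt_const hR] with n hn hn'
    refine lt_of_le_of_lt ?_ hn'
    -- Summing the lower bounds over `r < R` gives `P 0 * T - ∑ η ≤ ∑ P r ≤ 1`.
    rw [← div_eq_mul_inv, le_div_iff₀ hT0, hTdef, mul_sum]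
    have h1 := sum_le_sum hn
    rw [sum_sub_distrib] at h1
    have h2 := sum_uniProb_le_one (U := U n) (s := s) (hp0 n) (hp1 n) R
    linarith

end Limits

/-! ### The event that the fragment is a given hypergraph -/

section Fragment

variable {V : Type*} [Fintype V] {d s : ℕ} {S T F : Finset (Finset V)} {x : V} {A W : Finset V}
  {p : ℝ}

/-- Whether a component is unicyclic depends only on the edges that meet it. -/
theorem unicyclic_congr (hS : ∀ e ∈ S, e.Nonempty) (hT : ∀ e ∈ T, e.Nonempty)
    (hA : reach {x} S ⊆ A) (h : ∀ e, ∀ v ∈ e, v ∈ A → (e ∈ S ↔ e ∈ T)) :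
    Unicyclic d S x ↔ Unicyclic d T x := by
  have hTS : reach {x} T ⊆ reach {x} S := reach_subset subset_reach fun e he v hv hvS =>
    edge_subset_reach ((h e v hv (hA hvS)).2 he) hv hvS
  have hST : reach {x} S ⊆ reach {x} T := reach_subset subset_reach fun e he v hv hvT =>
    edge_subset_reach ((h e v hv (hA (hTS hvT))).1 he) hv hvT
  have hreach := hST.antisymm hTS
  have hinner : inner {x} S = inner {x} T := by
    ext e
    rw [mem_inner, mem_inner, hreach]
    refine and_congr_left fun he => ?_
    constructor
    · intro heS
      obtain ⟨v, hv⟩ := hS e heS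
      exact (h e v hv (hA (hTS (he hv)))).1 heS
    · intro heT
      obtain ⟨v, hv⟩ := hT e heT
      exact (h e v hv (hA (hTS (he hv)))).2 heT
  rw [Unicyclic, Unicyclic, hreach, hinner]

open Classical in
/-- The vertices of the fragment. -/
noncomputable def fragVertices (d : ℕ) (S : Finset (Finset V)) : Finset V :=
  {x | Unicyclic d S x}

open Classical in
/-- The edges of the fragment. -/
noncomputable def fragEdges (d : ℕ) (S : Finset (Finset V)) : Finset (Finset V) :=
  {e ∈ S | e ⊆ fragVertices d S}

theorem mem_fragVertices : x ∈ fragVertices d S ↔ Unicyclic d S x := by simp [fragVertices]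

theorem mem_fragEdges {e : Finset V} :
    e ∈ fragEdges d S ↔ e ∈ S ∧ e ⊆ fragVertices d S := by simp [fragEdges]

theorem edge_subset_fragVertices {e : Finset V} {v : V} (he : e ∈ S) (hv : v ∈ e)
    (h : Unicyclic d S v) : e ⊆ fragVertices d S := fun _ hw =>
  mem_fragVertices.2 <| (unicyclic_iff_of_mem (edge_subset_reach he hv
    (subset_reach (mem_singleton_self v)) hw)).2 h

theorem unicycles_eq_empty_iff : unicycles d S = ∅ ↔ ∀ x, ¬ Unicyclic d S x := by
  simp [Finset.eq_empty_iff_forall_notMem, mem_unicycles]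

theorem not_unicyclic_empty : ¬ Unicyclic d (∅ : Finset (Finset V)) x := by
  rw [Unicyclic, reach_eq_self (by simp)]
  simp [inner]

variable [DecidableEq V]

/-- The description of the event that the fragment is a given hypergraph. -/
theorem fragment_eq_iff (hd : 1 ≤ d) (hS : S ⊆ powersetCard d univ)
    (hF : F ⊆ powersetCard d W) (hu : ∀ x ∈ W, Unicyclic d F x) :
    (fragVertices d S = W ∧ fragEdges d S = F) ↔
      (S ∩ (powersetCard d univ \ powersetCard d Wᶜ) = F ∧
        unicycles d (S ∩ powersetCard d Wᶜ) = ∅) := by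
  have hSne : ∀ e ∈ S, e.Nonempty := fun e he =>
    card_pos.1 (by rw [(mem_powersetCard.1 (hS he)).2]; exact hd)
  have hFne : ∀ e ∈ F, e.Nonempty := fun e he =>
    card_pos.1 (by rw [(mem_powersetCard.1 (hF he)).2]; exact hd)
  have hS2ne : ∀ e ∈ S ∩ powersetCard d Wᶜ, e.Nonempty := fun e he => hSne e (mem_inter.1 he).1
  have hmeet : ∀ e ∈ S, (e ∈ powersetCard d univ \ powersetCard d Wᶜ ↔ ∃ v ∈ e, v ∈ W) := by
    intro e he
    have := mem_powersetCard.1 (hS he)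
    simp only [Finset.mem_sdiff, mem_powersetCard, this, true_and, and_true, Finset.not_subset,
      mem_compl, not_not]
  have hsplit : ∀ e ∈ S, e ∉ powersetCard d univ \ powersetCard d Wᶜ → e ∈ powersetCard d Wᶜ :=
    fun e he h => by
      rw [Finset.mem_sdiff, not_and, not_not] at h
      exact h (hS he)
  rw [unicycles_eq_empty_iff]
  constructor
  · rintro ⟨hV, hE⟩
    have hFS : F ⊆ S := fun e he => by
      rw [← hE] at he
      exact (mem_fragEdges.1 he).1
    have hSF : ∀ e ∈ S, ∀ v ∈ e, v ∈ W → e ∈ F := by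
      intro e he v hv hvW
      rw [← hV, mem_fragVertices] at hvW
      rw [← hE]
      exact mem_fragEdges.2 ⟨he, edge_subset_fragVertices he hv hvW⟩
    refine ⟨?_, fun x hx => ?_⟩
    · ext e
      rw [mem_inter]
      constructor
      · rintro ⟨he, h⟩
        obtain ⟨v, hv, hvW⟩ := (hmeet e he).1 h
        exact hSF e he v hv hvW
      · intro he
        refine ⟨hFS he, (hmeet e (hFS he)).2 ?_⟩
        obtain ⟨v, hv⟩ := hFne e he
        exact ⟨v, hv, (mem_powersetCard.1 (hF he)).1 hv⟩
    · by_cases hxW : x ∈ W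
      -- A vertex of `W` is isolated among the edges inside `Wᶜ`, and an isolated vertex is not
      -- unicyclic.
      · refine not_unicyclic_empty ((unicyclic_congr (S := ∅) (A := W) (by simp) hS2ne ?_ ?_).2 hx)
        · rw [reach_eq_self (by simp)]
          simpa using hxW
        · intro e v hv hvW
          simp only [notMem_empty, false_iff, mem_inter, mem_powersetCard, not_and]
          intro _ h
          exact absurd hvW (mem_compl.1 (h hv))
      · refine hxW ?_
        rw [← hV, mem_fragVertices]
        refine (unicyclic_congr (A := Wᶜ) hSne hS2ne ?_ ?_).2 hx
        · intro y hy
          rw [mem_compl]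
          intro hyW
          rw [← hV, mem_fragVertices, unicyclic_iff_of_mem hy, ← mem_fragVertices, hV] at hyW
          exact hxW hyW
        · intro e v hv hvW
          rw [mem_inter]
          refine ⟨fun he => ⟨he, hsplit e he fun h => ?_⟩, fun h => h.1⟩
          obtain ⟨w, hw, hwW⟩ := (hmeet e he).1 h
          exact mem_compl.1 hvW ((mem_powersetCard.1 (hF (hSF e he w hw hwW))).1 hv)
  · rintro ⟨h1, h2⟩
    have hFS : F ⊆ S := h1 ▸ inter_subset_left
    have hSF : ∀ e ∈ S, ∀ v ∈ e, v ∈ W → e ∈ F := by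
      intro e he v hv hvW
      rw [← h1]
      exact mem_inter.2 ⟨he, (hmeet e he).2 ⟨v, hv, hvW⟩⟩
    have hV : fragVertices d S = W := by
      ext x
      rw [mem_fragVertices]
      by_cases hxW : x ∈ W
      · refine iff_of_true ((unicyclic_congr (A := W) hFne hSne ?_ ?_).1 (hu x hxW)) hxW
        · refine reach_subset (singleton_subset_iff.2 hxW) fun e he _ _ _ =>
            (mem_powersetCard.1 (hF he)).1
        · exact fun e v hv hvW => ⟨fun he => hFS he, fun he => hSF e he v hv hvW⟩
      · refine iff_of_false (fun hx => h2 x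
          ((unicyclic_congr (A := Wᶜ) hS2ne hSne ?_ ?_).2 hx)) hxW
        · refine reach_subset (singleton_subset_iff.2 (mem_compl.2 hxW)) fun e he _ _ _ =>
            (mem_powersetCard.1 (mem_inter.1 he).2).1
        · intro e v hv hvW
          rw [mem_inter]
          refine ⟨fun h => h.1, fun he => ⟨he, hsplit e he fun h => ?_⟩⟩
          obtain ⟨w, hw, hwW⟩ := (hmeet e he).1 h
          exact mem_compl.1 hvW ((mem_powersetCard.1 (hF (hSF e he w hw hwW))).1 hv)
    refine ⟨hV, ?_⟩
    ext e
    rw [mem_fragEdges, hV]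
    constructor
    · rintro ⟨he, heW⟩
      obtain ⟨v, hv⟩ := hSne e he
      exact hSF e he v hv (heW hv)
    · exact fun he => ⟨hFS he, (mem_powersetCard.1 (hF he)).1⟩

/-- The two conditions of `fragment_eq_iff` concern disjoint sets of potential edges and are
independent. The exponent of `1 - p` is the number of `d`-sets that meet `W` and are not in `F`. -/
theorem prob_fragment_eq (hF : F ⊆ powersetCard (s + 2) W)
    (hu : ∀ x ∈ W, Unicyclic (s + 2) F x) :
    prob (powersetCard (s + 2) univ) p
      (fun S => fragVertices (s + 2) S = W ∧ fragEdges (s + 2) S = F) =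
    p ^ #F * (1 - p) ^ ((Fintype.card V).choose (s + 2) - (Fintype.card V - #W).choose (s + 2) -
      #F) * uniProb Wᶜ s p 0 := by
  have hsub : powersetCard (s + 2) Wᶜ ⊆ powersetCard (s + 2) (univ : Finset V) :=
    powersetCard_mono (subset_univ _)
  have hF' : F ⊆ powersetCard (s + 2) univ \ powersetCard (s + 2) Wᶜ := by
    intro e he
    have h := mem_powersetCard.1 (hF he)
    refine mem_sdiff.2 ⟨mem_powersetCard.2 ⟨subset_univ _, h.2⟩, fun h' => ?_⟩
    obtain ⟨v, hv⟩ := card_pos.1 (by rw [h.2]; omega : 0 < #e)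
    exact mem_compl.1 ((mem_powersetCard.1 h').1 hv) (h.1 hv)
  have h := prob_inter_eq_and (p := p) (A := fun S => unicycles (s + 2) S = ∅)
    (sdiff_disjoint (s := powersetCard (s + 2) Wᶜ) (t := powersetCard (s + 2) univ)) hF'
  rw [sdiff_union_of_subset hsub, card_sdiff_of_subset hsub, card_powersetCard,
    card_powersetCard, card_compl, card_univ] at h
  rw [prob_congr fun S hS => fragment_eq_iff (by omega) hS hF hu, h, uniProb]
  simp only [card_eq_zero]

/-- A union of unicycles has `d - 1` times as many vertices as edges. -/
theorem card_eq_of_unicyclic (hd : 1 ≤ d) (hF : F ⊆ powersetCard d W)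
    (hu : ∀ x ∈ W, Unicyclic d F x) : #W = (d - 1) * #F := by
  have hreach : ∀ x ∈ W, reach {x} F ⊆ W := fun x hx =>
    reach_subset (singleton_subset_iff.2 hx) fun e he _ _ _ => (mem_powersetCard.1 (hF he)).1
  have hself : ∀ x : V, x ∈ reach {x} F := fun x => subset_reach (mem_singleton_self x)
  set I := W.image fun x => reach {x} F with hI
  have hmeet : ∀ K ∈ I, ∀ K' ∈ I, ∀ v ∈ K, v ∈ K' → K = K' := by
    intro K hK K' hK' v hv hv'
    obtain ⟨x, -, rfl⟩ := mem_image.1 hK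
    obtain ⟨y, -, rfl⟩ := mem_image.1 hK'
    rw [← reach_eq_of_mem hv, reach_eq_of_mem hv']
  have hFne : ∀ e ∈ F, e.Nonempty := fun e he =>
    card_pos.1 (by rw [(mem_powersetCard.1 (hF he)).2]; exact hd)
  have hW : W = I.biUnion id := by
    ext x
    simp only [hI, mem_biUnion, mem_image, id, exists_exists_and_eq_and]
    exact ⟨fun hx => ⟨x, hx, hself x⟩, fun ⟨y, hy, hxy⟩ => hreach y hy hxy⟩
  have hFI : F = I.biUnion fun K => {e ∈ F | e ⊆ K} := by
    ext e
    simp only [hI, mem_biUnion, mem_image, exists_exists_and_eq_and, mem_filter]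
    refine ⟨fun he => ?_, fun ⟨y, hy, he, _⟩ => he⟩
    obtain ⟨v, hv⟩ := hFne e he
    exact ⟨v, (mem_powersetCard.1 (hF he)).1 hv, he, edge_subset_reach he hv (hself v)⟩
  have h1 : #W = ∑ K ∈ I, #K := by
    conv_lhs => rw [hW]
    refine card_biUnion fun K hK K' hK' hne => Finset.disjoint_left.2 fun v hv hv' => ?_
    exact hne (hmeet K hK K' hK' v hv hv')
  have h2 : #F = ∑ K ∈ I, #{e ∈ F | e ⊆ K} := by
    conv_lhs => rw [hFI]
    refine card_biUnion fun K hK K' hK' hne => Finset.disjoint_left.2 fun e he he' => ?_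
    rw [mem_filter] at he he'
    obtain ⟨v, hv⟩ := hFne e he.1
    exact hne (hmeet K hK K' hK' v (he.2 hv) (he'.2 hv))
  rw [h1, h2, mul_sum]
  refine sum_congr rfl fun K hK => ?_
  obtain ⟨x, hx, rfl⟩ := mem_image.1 hK
  have := hu x hx
  rw [Unicyclic, inner] at this
  rw [← this]
  congr!

end Fragment

/-! ### Translation between hypergraphs and finite edge families -/

section Transfer

variable {α V : Type*} {H : Hypergraph α} {d : ℕ}

/-- The image of an edge under an embedding of the vertex set. -/
def imageEdge (φ : H.vertexSet ↪ V) (e : Set α) : Set V := φ '' (Subtype.val ⁻¹' e)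

theorem mem_imageEdge {φ : H.vertexSet ↪ V} {e : Set α} {x : H.vertexSet} :
    φ x ∈ imageEdge φ e ↔ (x : α) ∈ e := by
  simp [imageEdge]

theorem imageEdge_subset_iff {φ : H.vertexSet ↪ V} {e f : Set α} (he : e ⊆ H.vertexSet) :
    imageEdge φ e ⊆ imageEdge φ f ↔ e ⊆ f := by
  refine ⟨fun h x hx => ?_, fun h => Set.image_mono (Set.preimage_mono h)⟩
  exact mem_imageEdge (x := ⟨x, he hx⟩).1 (h (mem_imageEdge (x := ⟨x, he hx⟩).2 hx))

theorem imageEdge_injOn (φ : H.vertexSet ↪ V) :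
    Set.InjOn (imageEdge φ) {e | e ⊆ H.vertexSet} := fun _ he _ hf h =>
  ((imageEdge_subset_iff he).1 h.le).antisymm ((imageEdge_subset_iff hf).1 h.ge)

theorem ncard_imageEdge {φ : H.vertexSet ↪ V} {e : Set α} (he : e ⊆ H.vertexSet) :
    (imageEdge φ e).ncard = e.ncard := by
  rw [imageEdge, Set.ncard_image_of_injective _ φ.injective,
    Set.ncard_preimage_of_injective_subset_range Subtype.val_injective (by simpa using he)]

/-- The image of a hypergraph under an embedding of its vertex set. -/
def image (H : Hypergraph α) (φ : H.vertexSet ↪ V) : Hypergraph V where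
  vertexSet := Set.range φ
  edgeSet := imageEdge φ '' H.edgeSet
  subset_vertexSet_of_mem_edgeSet' := by
    rintro _ ⟨e, -, rfl⟩
    exact Set.image_subset_range _ _

/-- Every component is connected. -/
theorem component_isConnected {x : α} (hx : x ∈ H.vertexSet) : (H.component x).IsConnected := by
  have key : ∀ y, Relation.ReflTransGen H.Adj x y →
      Relation.ReflTransGen (H.component x).Adj x y := by
    intro y h
    induction h with
    | refl => exact .refl
    | @tail b c hb hbc ih =>
      obtain ⟨e, he, hbe, hce⟩ := hbc
      exact ih.tail ⟨e, ⟨he, fun w hw => ⟨H.subset_vertexSet_of_mem_edgeSet' he hw,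
        hb.tail ⟨e, he, hbe, hw⟩⟩⟩, hbe, hce⟩
  have : Std.Symm (H.component x).Adj := ⟨fun _ _ h => h.symm⟩
  exact ⟨⟨x, hx, .refl⟩, fun y hy z hz => (Std.Symm.symm _ _ (key y hy.2)).trans (key z hz.2)⟩

theorem component_isUnicycle_iff {x : α} (hx : x ∈ H.vertexSet) (hfin : H.vertexSet.Finite)
    (hH : H.IsUniform d) (hd : 1 ≤ d) : (H.component x).IsUnicycle d ↔
      (d - 1) * (H.component x).size = (H.component x).vertexSet.ncard := by
  have h1 : (H.component x).vertexSet.Finite := hfin.subset fun y hy => hy.1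
  have h2 : (H.component x).IsUniform d := fun e he => hH e he.1
  rw [Hypergraph.IsUnicycle]
  simp only [h1, h2, component_isConnected hx, true_and, Hypergraph.excess, sub_eq_zero]
  rw [← Nat.cast_inj (R := ℤ), Nat.cast_mul, Nat.cast_sub hd, Nat.cast_one]

/-- A family of finsets as a set of sets. -/
def toSets (S : Finset (Finset V)) : Set (Set V) := (↑) '' (S : Set (Finset V))

theorem toSets_injective : Function.Injective (toSets : Finset (Finset V) → Set (Set V)) :=
  (Set.image_injective.2 coe_injective).comp coe_injective

theorem coe_mem_toSets {S : Finset (Finset V)} {e : Finset V} : (e : Set V) ∈ toSets S ↔ e ∈ S := by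
  simp [toSets]

variable [Fintype V]

theorem reflTransGen_linked_iff {φ : H.vertexSet ↪ V} {F : Finset (Finset V)}
    (hF : ∀ f : Finset V, f ∈ F ↔ ∃ e ∈ H.edgeSet, imageEdge φ e = f) {x : H.vertexSet} {v : V} :
    Relation.ReflTransGen (Linked F) (φ x) v ↔
      ∃ y : H.vertexSet, φ y = v ∧ Relation.ReflTransGen H.Adj (x : α) y := by
  constructor
  · intro h
    induction h with
    | refl => exact ⟨x, rfl, .refl⟩
    | tail _ hbc ih =>
      obtain ⟨y, rfl, hy⟩ := ih
      obtain ⟨f, hf, hbf, hcf⟩ := hbc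
      obtain ⟨e, he, hef⟩ := (hF f).1 hf
      rw [← mem_coe, ← hef] at hbf hcf
      obtain ⟨z, hz, rfl⟩ := hcf
      exact ⟨z, rfl, hy.tail ⟨e, he, mem_imageEdge.1 hbf, hz⟩⟩
  · rintro ⟨⟨y, hy⟩, rfl, h⟩
    simp only at h
    induction h with
    | refl => exact .refl
    | @tail b c hb hbc ih =>
      obtain ⟨e, he, hbe, hce⟩ := hbc
      have hbV := H.subset_vertexSet_of_mem_edgeSet' he hbe
      refine (ih hbV).tail ⟨(Set.toFinite (imageEdge φ e)).toFinset, (hF _).2 ⟨e, he, by simp⟩,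
        ?_, ?_⟩
      · rw [Set.Finite.mem_toFinset]
        exact mem_imageEdge.2 hbe
      · rw [Set.Finite.mem_toFinset]
        exact mem_imageEdge.2 hce

theorem coe_reach {φ : H.vertexSet ↪ V} {F : Finset (Finset V)}
    (hF : ∀ f : Finset V, f ∈ F ↔ ∃ e ∈ H.edgeSet, imageEdge φ e = f) (x : H.vertexSet) :
    (reach {φ x} F : Set V) = imageEdge φ (H.component x).vertexSet := by
  ext v
  rw [mem_coe, mem_reach_singleton, reflTransGen_linked_iff hF]
  constructor
  · rintro ⟨y, rfl, hy⟩
    exact mem_imageEdge.2 ⟨y.2, hy⟩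
  · rintro ⟨y, hy, rfl⟩
    exact ⟨y, rfl, hy.2⟩

/-- An embedding carries components to components with their numbers of vertices and edges. It is
applied to the random hypergraph with the inclusion map, and to `H` with an arbitrary embedding. -/
theorem unicyclic_iff {φ : H.vertexSet ↪ V} {F : Finset (Finset V)}
    (hF : ∀ f : Finset V, f ∈ F ↔ ∃ e ∈ H.edgeSet, imageEdge φ e = f) (x : H.vertexSet)
    (hfin : H.vertexSet.Finite) (hH : H.IsUniform d) (hd : 1 ≤ d) :
    Unicyclic d F (φ x) ↔ (H.component x).IsUnicycle d := by
  rw [component_isUnicycle_iff x.2 hfin hH hd, Unicyclic]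
  have h1 : #(reach {φ x} F) = (H.component x).vertexSet.ncard := by
    rw [← ncard_imageEdge (φ := φ) fun y hy => hy.1, ← coe_reach hF, Set.ncard_coe_finset]
  have h2 : #(inner {φ x} F) = (H.component x).size := by
    have h3 : ((↑) : Finset V → Set V) '' (inner {φ x} F : Set (Finset V)) =
        imageEdge φ '' (H.component x).edgeSet := by
      ext f
      simp only [Set.mem_image, mem_coe, mem_inner]
      constructor
      · rintro ⟨f, ⟨hf, hfr⟩, rfl⟩
        obtain ⟨e, he, hef⟩ := (hF f).1 hf
        refine ⟨e, ⟨he, ?_⟩, hef⟩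
        rw [← coe_subset, coe_reach hF, ← hef,
          imageEdge_subset_iff (H.subset_vertexSet_of_mem_edgeSet' he)] at hfr
        exact hfr
      · rintro ⟨e, he, rfl⟩
        refine ⟨(Set.toFinite (imageEdge φ e)).toFinset, ⟨(hF _).2 ⟨e, he.1, by simp⟩, ?_⟩,
          by simp⟩
        rw [← coe_subset, coe_reach hF, Set.Finite.coe_toFinset]
        exact (imageEdge_subset_iff (H.subset_vertexSet_of_mem_edgeSet' he.1)).2 he.2
    rw [Hypergraph.size, ← ((imageEdge_injOn φ).mono fun e he =>
      H.subset_vertexSet_of_mem_edgeSet' he.1).ncard_image, ← h3,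
      Set.ncard_image_of_injective _ coe_injective, Set.ncard_coe_finset]
  rw [h1, h2]

theorem unicyclic_iff_ofEdges {S : Finset (Finset V)} (hS : ∀ e ∈ S, #e = d) (hd : 1 ≤ d)
    (x : V) : Unicyclic d S x ↔ ((Hypergraph.ofEdges (toSets S)).component x).IsUnicycle d := by
  refine unicyclic_iff (H := Hypergraph.ofEdges (toSets S))
    (φ := Function.Embedding.subtype _) ?_ ⟨x, Set.mem_univ x⟩ (Set.toFinite _) ?_ hd
  · intro f
    have h : ∀ e : Set V, imageEdge (H := Hypergraph.ofEdges (toSets S))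
        (Function.Embedding.subtype _) e = e := fun e => by
      ext v
      constructor
      · rintro ⟨y, hy, rfl⟩
        exact hy
      · exact fun hv => ⟨⟨v, Set.mem_univ v⟩, hv, rfl⟩
    simp only [h, exists_eq_right]
    exact coe_mem_toSets.symm
  · rintro _ ⟨e, he, rfl⟩
    rw [Set.ncard_coe_finset]
    exact hS e he

theorem vertexSet_fragment {S : Finset (Finset V)} (hS : ∀ e ∈ S, #e = d) (hd : 1 ≤ d) :
    ((Hypergraph.ofEdges (toSets S)).fragment d).vertexSet = fragVertices d S := by
  ext y
  rw [mem_coe, mem_fragVertices, unicyclic_iff_ofEdges hS hd]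
  refine ⟨fun ⟨x, _, hxu, hxy⟩ => ?_, fun h => ⟨y, Set.mem_univ y, h, Set.mem_univ y, .refl⟩⟩
  rw [← unicyclic_iff_ofEdges hS hd] at hxu ⊢
  refine (unicyclic_iff_of_mem (mem_reach_singleton.2 ?_)).2 hxu
  refine Relation.ReflTransGen.mono ?_ _ _ hxy.2
  rintro a b ⟨_, ⟨e, he, rfl⟩, ha, hb⟩
  exact ⟨e, he, ha, hb⟩

theorem edgeSet_fragment {S : Finset (Finset V)} (hS : ∀ e ∈ S, #e = d) (hd : 1 ≤ d) :
    ((Hypergraph.ofEdges (toSets S)).fragment d).edgeSet = toSets (fragEdges d S) := by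
  ext f
  constructor
  · rintro ⟨x, hx, hxu, ⟨e, he, rfl⟩, hex⟩
    refine coe_mem_toSets.2 (mem_fragEdges.2 ⟨he, fun y hy => ?_⟩)
    rw [← mem_coe, ← vertexSet_fragment hS hd]
    exact ⟨x, hx, hxu, hex hy⟩
  · rintro ⟨e, he, rfl⟩
    obtain ⟨heS, hef⟩ := mem_fragEdges.1 (mem_coe.1 he)
    obtain ⟨v, hv⟩ := card_pos.1 (by rw [hS e heS]; exact hd : 0 < #e)
    refine ⟨v, Set.mem_univ v, ?_, coe_mem_toSets.2 heS, fun w hw => ⟨Set.mem_univ w, ?_⟩⟩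
    · rw [← unicyclic_iff_ofEdges hS hd]
      exact mem_fragVertices.1 (hef hv)
    · exact .single ⟨e, coe_mem_toSets.2 heS, hv, hw⟩

open Classical in
/-- The edges of the image of a hypergraph, as finsets. -/
noncomputable def imageEdges (H : Hypergraph α) (φ : H.vertexSet ↪ V) : Finset (Finset V) :=
  {f | ∃ e ∈ H.edgeSet, imageEdge φ e = f}

theorem mem_imageEdges {φ : H.vertexSet ↪ V} {f : Finset V} :
    f ∈ imageEdges H φ ↔ ∃ e ∈ H.edgeSet, imageEdge φ e = f := by
  simp [imageEdges]

theorem toSets_imageEdges (φ : H.vertexSet ↪ V) :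
    toSets (imageEdges H φ) = imageEdge φ '' H.edgeSet := by
  ext f
  constructor
  · rintro ⟨f, hf, rfl⟩
    exact mem_imageEdges.1 hf
  · rintro ⟨e, he, rfl⟩
    exact ⟨(Set.toFinite (imageEdge φ e)).toFinset, mem_imageEdges.2 ⟨e, he, by simp⟩, by simp⟩

theorem card_imageEdges (φ : H.vertexSet ↪ V) : #(imageEdges H φ) = H.size := by
  rw [← Set.ncard_coe_finset, ← Set.ncard_image_of_injective _ coe_injective]
  change (toSets (imageEdges H φ)).ncard = _
  rw [toSets_imageEdges, ((imageEdge_injOn φ).mono fun e he =>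
      H.subset_vertexSet_of_mem_edgeSet' he).ncard_image, Hypergraph.size]

theorem fragment_eq_image_iff [Fintype H.vertexSet] {S : Finset (Finset V)}
    (hS : ∀ e ∈ S, #e = d) (hd : 1 ≤ d) (φ : H.vertexSet ↪ V) :
    (Hypergraph.ofEdges (toSets S)).fragment d = image H φ ↔
      fragVertices d S = univ.map φ ∧ fragEdges d S = imageEdges H φ := by
  have hE : (image H φ).edgeSet = toSets (imageEdges H φ) := (toSets_imageEdges φ).symm
  rw [Hypergraph.ext_iff, vertexSet_fragment hS hd, edgeSet_fragment hS hd, hE,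
    toSets_injective.eq_iff, ← coe_inj (s₂ := univ.map φ), coe_map, coe_univ, Set.image_univ]
  rfl

theorem imageEdges_subset [Fintype H.vertexSet] (hH : H.IsUniform d) (φ : H.vertexSet ↪ V) :
    imageEdges H φ ⊆ powersetCard d (univ.map φ) := by
  intro f hf
  obtain ⟨e, he, hef⟩ := mem_imageEdges.1 hf
  refine mem_powersetCard.2 ⟨?_, ?_⟩
  · rw [← coe_subset, ← hef, coe_map, coe_univ]
    exact Set.image_mono (Set.subset_univ _)
  · rw [← Set.ncard_coe_finset, ← hef, ncard_imageEdge (H.subset_vertexSet_of_mem_edgeSet' he)]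
    exact hH e he

theorem unicyclic_imageEdges [Fintype H.vertexSet] (hH : H.HasUnicyclicComponents d) (hd : 1 ≤ d)
    (φ : H.vertexSet ↪ V) : ∀ v ∈ univ.map φ, Unicyclic d (imageEdges H φ) v := by
  intro v hv
  obtain ⟨x, -, rfl⟩ := Finset.mem_map.1 hv
  exact (unicyclic_iff (fun f => mem_imageEdges) x hH.1 hH.2.1 hd).2 (hH.2.2 x x.2)

end Transfer

/-! ### Embeddings, copies and automorphisms -/

section Isomorphism

variable {α V : Type*} {H : Hypergraph α}

/-- Two embeddings with the same image differ by a permutation of the vertices of `H`, and equal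
edge sets mean that it is an automorphism. So the embeddings onto a fixed copy form a torsor under
the automorphisms. -/
theorem image_trans_eq_iff (φ : H.vertexSet ↪ V) (σ : H.vertexSet ≃ H.vertexSet) :
    image H φ = image H (σ.toEmbedding.trans φ) ↔ H.IsIsomorphism H σ := by
  have hedge : ∀ e : Set α, imageEdge (σ.toEmbedding.trans φ) e =
      imageEdge φ (Subtype.val '' (σ '' (Subtype.val ⁻¹' e))) := by
    intro e
    rw [imageEdge, imageEdge, Set.preimage_image_eq _ Subtype.val_injective, Set.image_image]
    rfl
  have hself : ∀ s : Set H.vertexSet, Subtype.val ⁻¹' (Subtype.val '' s) = s := fun s =>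
    Set.preimage_image_eq _ Subtype.val_injective
  have hsub : ∀ s : Set H.vertexSet, Subtype.val '' s ⊆ H.vertexSet := fun s => by simp
  have hback : ∀ e ∈ H.edgeSet, Subtype.val '' (Subtype.val ⁻¹' e : Set H.vertexSet) = e := by
    intro e he
    rw [Subtype.image_preimage_coe, Set.inter_eq_right]
    exact H.subset_vertexSet_of_mem_edgeSet' he
  have hV : (image H φ).vertexSet = (image H (σ.toEmbedding.trans φ)).vertexSet :=
    (σ.surjective.range_comp φ).symm
  rw [Hypergraph.ext_iff, and_iff_right hV]
  constructor
  · intro h s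
    have h' := Set.ext_iff.1 h (imageEdge φ (Subtype.val '' (σ '' s)))
    constructor
    · intro hs
      obtain ⟨e, he, hee⟩ := h'.2 ⟨_, hs, by rw [hedge, hself]⟩
      rwa [← imageEdge_injOn φ (H.subset_vertexSet_of_mem_edgeSet' he) (hsub _) hee]
    · intro hs
      obtain ⟨e, he, hee⟩ := h'.1 ⟨_, hs, rfl⟩
      rw [hedge] at hee
      have h2 := imageEdge_injOn φ (hsub _) (hsub _) hee
      have h3 := σ.injective.image_injective (Subtype.val_injective.image_injective h2)
      rw [← h3, hback e he]
      exact he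
  · intro h
    apply Set.Subset.antisymm
    · rintro _ ⟨e, he, rfl⟩
      have h1 := h (σ.symm '' (Subtype.val ⁻¹' e))
      rw [Equiv.image_symm_image, hback e he] at h1
      exact ⟨_, h1.2 he, by rw [hedge, hself, Equiv.image_symm_image, hback e he]⟩
    · rintro _ ⟨e, he, rfl⟩
      have h1 := h (Subtype.val ⁻¹' e)
      rw [hback e he] at h1
      exact ⟨_, h1.1 he, (hedge e).symm⟩

theorem isIsomorphic_iff_exists_image {K : Hypergraph V} :
    K.IsIsomorphic H ↔ ∃ φ : H.vertexSet ↪ V, K = image H φ := by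
  constructor
  · rintro ⟨ψ, hψ⟩
    refine ⟨ψ.symm.toEmbedding.trans (Function.Embedding.subtype _), ?_⟩
    have hedge : ∀ s : Set K.vertexSet,
        imageEdge (ψ.symm.toEmbedding.trans (Function.Embedding.subtype _))
          (Subtype.val '' (ψ '' s)) = Subtype.val '' s := by
      intro s
      rw [imageEdge, Set.preimage_image_eq _ Subtype.val_injective, Set.image_image]
      simp
    apply Hypergraph.ext
    · ext v
      simp only [image, Set.mem_range]
      constructor
      · exact fun hv => ⟨ψ ⟨v, hv⟩, by simp⟩
      · rintro ⟨y, rfl⟩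
        exact (ψ.symm y).2
    · ext f
      constructor
      · intro hf
        have hfs : Subtype.val '' (Subtype.val ⁻¹' f : Set K.vertexSet) = f := by
          rw [Subtype.image_preimage_coe, Set.inter_eq_right]
          exact K.subset_vertexSet_of_mem_edgeSet' hf
        refine ⟨_, (hψ (Subtype.val ⁻¹' f)).1 (by rwa [hfs]), ?_⟩
        rw [hedge, hfs]
      · rintro ⟨e, he, rfl⟩
        have hes : Subtype.val '' (ψ '' (ψ.symm '' (Subtype.val ⁻¹' e))) = e := by
          rw [Equiv.image_symm_image, Subtype.image_preimage_coe, Set.inter_eq_right]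
          exact H.subset_vertexSet_of_mem_edgeSet' he
        rw [← hes, hedge]
        exact (hψ _).2 (by rwa [hes])
  · rintro ⟨φ, rfl⟩
    refine ⟨(Equiv.ofInjective φ φ.injective).symm, fun s => ?_⟩
    set ψ : (image H φ).vertexSet ≃ H.vertexSet := (Equiv.ofInjective φ φ.injective).symm with hψ
    have hφ : ∀ y, φ (ψ y) = y := fun y => Equiv.apply_ofInjective_symm φ.injective y
    have hedge : imageEdge φ (Subtype.val '' (ψ '' s)) = Subtype.val '' s := by
      rw [imageEdge, Set.preimage_image_eq _ Subtype.val_injective, Set.image_image]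
      simp only [hφ]
    constructor
    · rintro ⟨e, he, hee⟩
      rw [← hedge] at hee
      rwa [← imageEdge_injOn φ (H.subset_vertexSet_of_mem_edgeSet' he) (by simp) hee]
    · intro h
      exact ⟨_, h, hedge⟩

/-- The number of embeddings of `H` with a given image. -/
theorem card_embeddings (K : Hypergraph V) [Decidable (K.IsIsomorphic H)] :
    Nat.card {φ : H.vertexSet ↪ V // K = image H φ} = if K.IsIsomorphic H then H.aut else 0 := by
  split_ifs with h
  · obtain ⟨φ₀, rfl⟩ := isIsomorphic_iff_exists_image.1 h
    refine (Nat.card_congr (Equiv.ofBijective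
      (fun σ : {σ : H.vertexSet ≃ H.vertexSet // H.IsIsomorphism H σ} =>
        (⟨σ.1.toEmbedding.trans φ₀, (image_trans_eq_iff φ₀ σ.1).2 σ.2⟩ :
          {φ : H.vertexSet ↪ V // image H φ₀ = image H φ})) ⟨?_, ?_⟩)).symm
    · intro σ τ hστ
      apply Subtype.ext
      ext x
      have := congrArg (fun f => f.1 x) hστ
      exact congrArg Subtype.val (φ₀.injective this)
    · rintro ⟨φ, hφ⟩
      have hrange : Set.range φ₀ = Set.range φ := congrArg Hypergraph.vertexSet hφ
      let σ : H.vertexSet ≃ H.vertexSet := (Equiv.ofInjective φ φ.injective).trans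
        ((Equiv.setCongr hrange.symm).trans (Equiv.ofInjective φ₀ φ₀.injective).symm)
      have hσ : σ.toEmbedding.trans φ₀ = φ := by
        ext x
        exact Equiv.apply_ofInjective_symm φ₀.injective _
      exact ⟨⟨σ, (image_trans_eq_iff φ₀ σ).1 (hσ.symm ▸ hφ)⟩, Subtype.ext hσ⟩
  · have : IsEmpty {φ : H.vertexSet ↪ V // K = image H φ} :=
      ⟨fun φ => h (isIsomorphic_iff_exists_image.2 ⟨φ.1, φ.2⟩)⟩
    exact Nat.card_of_isEmpty

/-- For each outcome the number of embeddings of `H` onto `K S` is `H.aut` or `0`; the expectation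
of this number is taken in two ways. -/
theorem prob_isIsomorphic_mul_aut {ι : Type*} [Fintype V] [Fintype H.vertexSet]
    [Fintype (H.vertexSet ↪ V)]
    (Ω : Finset ι) (p : ℝ) (K : Finset ι → Hypergraph V) :
    prob Ω p (fun S => (K S).IsIsomorphic H) * H.aut =
      ∑ φ : H.vertexSet ↪ V, prob Ω p (fun S => K S = image H φ) := by
  classical
  simp only [prob_eq_sum_ite]
  rw [Finset.sum_comm, Finset.sum_mul]
  refine Finset.sum_congr rfl fun S _ => ?_
  rw [← Finset.sum_filter, Finset.sum_const, nsmul_eq_mul, ← Fintype.card_subtype,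
    ← Nat.card_eq_fintype_card, card_embeddings]
  split_ifs <;> simp [mul_comm]

end Isomorphism

/-! ### The law of the random hypergraph as a finite sum -/

section Law

theorem binomialRandomEdges_real (d n : ℕ) (p : unitInterval) (Q : Set (Set (Fin n)) → Prop) :
    (Hypergraph.binomialRandomEdges d n p).real {S | Q S} =
      prob (powersetCard d (univ : Finset (Fin n))) p (fun S => Q (toSets S)) := by
  classical
  set Ω := powersetCard d (univ : Finset (Fin n))
  have hΩ : {e : Set (Fin n) | e.ncard = d} = toSets Ω := by
    ext e
    constructor
    · intro he
      refine ⟨e.toFinset, ?_, by simp⟩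
      have he' : e.ncard = d := he
      simp only [Ω, mem_coe, mem_powersetCard, subset_univ, true_and]
      rw [← he', Set.ncard_eq_toFinset_card']
    · rintro ⟨f, hf, rfl⟩
      have := (mem_powersetCard.1 (mem_coe.1 hf)).2
      simpa using this
  have hncard : ∀ T : Finset (Finset (Fin n)), (toSets T).ncard = #T := fun T => by
    rw [toSets, Set.ncard_image_of_injective _ coe_injective, Set.ncard_coe_finset]
  rw [Hypergraph.binomialRandomEdges, MeasureTheory.measureReal_def,
    ProbabilityTheory.setBernoulli_apply_eq_apply_subsets, ← MeasureTheory.measureReal_def, hΩ]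
  have hset : {S | S ∈ {S | Q S} ∧ S ⊆ toSets Ω} =
      ⋃ S ∈ ({S ∈ Ω.powerset | Q (toSets S)} : Finset _), {toSets S} := by
    ext S
    simp only [Set.mem_ofPred_eq, Set.mem_iUnion, mem_filter, mem_powerset, Set.mem_singleton_iff,
      exists_prop]
    constructor
    · rintro ⟨hQ, hS⟩
      obtain ⟨T, hT, rfl⟩ := Set.subset_image_iff.1 hS
      lift T to Finset (Finset (Fin n)) using Set.toFinite T
      exact ⟨T, ⟨coe_subset.1 hT, hQ⟩, rfl⟩
    · rintro ⟨T, ⟨hT, hQ⟩, rfl⟩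
      exact ⟨hQ, Set.image_mono (coe_subset.2 hT)⟩
  rw [hset, MeasureTheory.measureReal_biUnion_finset]
  · rw [prob]
    refine Finset.sum_congr (by congr!) fun S hS => ?_
    have hS' : S ⊆ Ω := mem_powerset.1 (mem_filter.1 hS).1
    have hsub : toSets S ⊆ toSets Ω := Set.image_mono (coe_subset.2 hS')
    rw [ProbabilityTheory.setBernoulli_real_singleton p hsub (Set.toFinite _),
      Set.ncard_sdiff hsub, hncard, hncard]
  · intro S _ T _ hST
    simpa using fun h => hST (toSets_injective h)
  · intro S _
    exact MeasurableSet.singleton _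

end Law

/-! ### The limit of the fragment probability -/

section Limit

theorem tendsto_one_sub_pow {p : ℕ → ℝ} {E : ℕ → ℕ} {L : ℝ} (hp0 : ∀ n, 0 ≤ p n)
    (hp : Tendsto p atTop (𝓝 0)) (hE : Tendsto (fun n => (E n : ℝ) * p n) atTop (𝓝 L)) :
    Tendsto (fun n => (1 - p n) ^ E n) atTop (𝓝 (Real.exp (-L))) := by
  have h1 : Tendsto (fun n => Real.exp (-((E n : ℝ) * p n / (1 - p n)))) atTop
      (𝓝 (Real.exp (-(L / (1 - 0))))) :=
    (Real.continuous_exp.tendsto _).comp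
      ((hE.div (tendsto_const_nhds.sub hp) (by norm_num)).neg)
  rw [sub_zero, div_one] at h1
  have h2 : Tendsto (fun n => Real.exp (-((E n : ℝ) * p n))) atTop (𝓝 (Real.exp (-L))) :=
    (Real.continuous_exp.tendsto _).comp hE.neg
  refine tendsto_of_tendsto_of_tendsto_of_le_of_le' h1 h2 ?_ ?_
  · filter_upwards [hp.eventually_lt_const one_pos] with n hn
    have := pow_le_pow_left₀ (Real.exp_pos _).le (exp_neg_div_le_one_sub (hp0 n) le_rfl hn) (E n)
    rw [← Real.exp_nat_mul] at this
    convert this using 2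
    ring
  · filter_upwards [hp.eventually_lt_const one_pos] with n hn
    have := pow_le_pow_left₀ (by linarith) (Real.one_sub_le_exp_neg (p n)) (E n)
    rw [← Real.exp_nat_mul] at this
    convert this using 2
    ring

/-- By Pascal's rule the difference telescopes into `m` terms `(n - i).choose s` with `1 ≤ i ≤ m`,
each asymptotic to `n ^ s / s!`. -/
theorem tendsto_choose_sub_choose_div_pow (m s : ℕ) :
    Tendsto (fun n : ℕ => ((n.choose (s + 1) : ℝ) - ((n - m).choose (s + 1) : ℝ)) / (n : ℝ) ^ s)
      atTop (𝓝 (m / (s.factorial : ℝ))) := by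
  induction m with
  | zero => simp
  | succ m ih =>
    have h := ih.add (tendsto_choose_div_pow (m + 1) s)
    rw [← add_div, ← Nat.cast_succ] at h
    refine h.congr' ?_
    filter_upwards [eventually_gt_atTop m] with n hn
    have h1 : n - m = n - (m + 1) + 1 := by omega
    rw [h1, Nat.choose_succ_succ, ← add_div]
    push_cast
    congr 1
    ring

theorem aut_pos {α : Type*} {H : Hypergraph α} (hfin : H.vertexSet.Finite) : 0 < H.aut := by
  have := hfin.to_subtype
  have : Nonempty {φ : H.vertexSet ≃ H.vertexSet // H.IsIsomorphism H φ} :=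
    ⟨⟨Equiv.refl _, fun s => by simp⟩⟩
  exact Nat.card_pos

theorem probFragment_mul_aut {α : Type*} {H : Hypergraph α} [Fintype H.vertexSet] {s : ℕ}
    (hH : H.HasUnicyclicComponents (s + 2)) (n : ℕ) (p : unitInterval) :
    Hypergraph.probFragment (s + 2) n p H * H.aut =
      ∑ φ : H.vertexSet ↪ Fin n, (p : ℝ) ^ H.size * (1 - p) ^ (n.choose (s + 2) -
        (n - Fintype.card H.vertexSet).choose (s + 2) - H.size) *
          uniProb (univ.map φ)ᶜ s p 0 := by
  rw [Hypergraph.probFragment, binomialRandomEdges_real, prob_isIsomorphic_mul_aut]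
  refine Finset.sum_congr rfl fun φ _ => ?_
  have h := prob_fragment_eq (p := p) (imageEdges_subset hH.2.1 φ)
    (unicyclic_imageEdges hH (by omega) φ)
  rw [card_imageEdges, Fintype.card_fin, card_map, card_univ] at h
  rw [← h]
  exact prob_congr fun S hS => fragment_eq_image_iff
    (fun e he => (mem_powersetCard.1 (hS he)).2) (by omega) φ

theorem card_vertexSet_eq {α : Type*} {H : Hypergraph α} [Fintype H.vertexSet] {s : ℕ}
    (hH : H.HasUnicyclicComponents (s + 2)) : Fintype.card H.vertexSet = (s + 1) * H.size := by
  classical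
  have h := card_eq_of_unicyclic (by omega)
    (imageEdges_subset hH.2.1 (Function.Embedding.refl H.vertexSet))
    (unicyclic_imageEdges hH (by omega) _)
  rwa [card_imageEdges, card_map, card_univ] at h

theorem tendsto_probFragment {α : Type*} {s : ℕ} (hs : 1 ≤ s) {c : ℝ} (hc0 : 0 < c)
    (hcs : c < s.factorial) {p : ℕ → unitInterval}
    (hp : Tendsto (fun n : ℕ => (n : ℝ) ^ (s + 1) * (p n : ℝ)) atTop (𝓝 c))
    {H : Hypergraph α} (hH : H.HasUnicyclicComponents (s + 2)) :
    Tendsto (fun n => Hypergraph.probFragment (s + 2) n (p n) H) atTop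
      (𝓝 (Real.exp (-cycleSeries (c / s.factorial)) *
        (c * Real.exp (-(c / s.factorial))) ^ H.size / H.aut)) := by
  classical
  have : Fintype H.vertexSet := hH.1.fintype
  set h := H.size with hh
  set m := Fintype.card H.vertexSet with hm
  have hmh : m = (s + 1) * h := card_vertexSet_eq hH
  have hp0 : ∀ n, (0 : ℝ) ≤ p n := fun n => (p n).2.1
  have hp1 : ∀ n, (p n : ℝ) ≤ 1 := fun n => (p n).2.2
  have haut : (0 : ℝ) < H.aut := by exact_mod_cast aut_pos hH.1
  have hplim : Tendsto (fun n => (p n : ℝ)) atTop (𝓝 0) := by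
    have := tendsto_edge_prob (V := fun n => Fin n) (U := fun n => univ) (s := s)
      (p := fun n => (p n : ℝ)) (c := c) (by simpa only [card_univ, Fintype.card_fin] using! tendsto_id)
      (by simpa using hp)
    exact this
  set E : ℕ → ℕ := fun n => n.choose (s + 2) - (n - m).choose (s + 2) - h with hE
  set D : ℕ → ℝ := fun n => n.descFactorial m * ((p n : ℝ) ^ h * (1 - p n) ^ E n) with hD
  have hElim : Tendsto (fun n => (E n : ℝ) * p n) atTop (𝓝 (h * (c / s.factorial))) := by
    have h1 := ((tendsto_choose_sub_choose_div_pow m (s + 1)).mul hp).sub (hplim.const_mul (h : ℝ))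
    -- Since `m = (s + 1) h`, the absent edges contribute `c / s!` for each edge of `H`; this is the
    -- source of `exp (-(c / s!))` in the base of the power.
    have h2 : (m : ℝ) / ((s + 1).factorial : ℝ) * c - h * 0 = h * (c / s.factorial) := by
      rw [hmh, Nat.factorial_succ]
      push_cast
      field_simp
      ring
    rw [h2] at h1
    -- The exponent `E n` is a truncated subtraction; it agrees with the real one as soon as at
    -- least `h` sets of size `s + 2` meet the copy.
    have hlarge : Tendsto (fun n : ℕ => ((n.choose (s + 2) : ℝ) - ((n - m).choose (s + 2) : ℝ)))
        atTop atTop ∨ h = 0 := by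
      rcases Nat.eq_zero_or_pos h with h0 | h0
      · exact Or.inr h0
      · left
        have hm0 : (0 : ℝ) < m / ((s + 1).factorial : ℝ) := by
          rw [hmh]
          positivity
        refine ((tendsto_choose_sub_choose_div_pow m (s + 1)).pos_mul_atTop hm0
          ((tendsto_pow_atTop (α := ℝ) (Nat.succ_ne_zero s)).comp
            tendsto_natCast_atTop_atTop)).congr' ?_
        filter_upwards [eventually_gt_atTop 0] with n hn
        have hn' : (0 : ℝ) < n := by exact_mod_cast hn
        simp only [Function.comp]
        field_simp
    have hge : ∀ᶠ n : ℕ in atTop,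
        (h : ℝ) ≤ (n.choose (s + 2) : ℝ) - ((n - m).choose (s + 2) : ℝ) := by
      rcases hlarge with hl | h0
      · exact hl.eventually_ge_atTop _
      · refine Eventually.of_forall fun n => ?_
        rw [h0, Nat.cast_zero, sub_nonneg]
        exact_mod_cast Nat.choose_le_choose _ (Nat.sub_le _ _)
    refine h1.congr' ?_
    filter_upwards [hge, eventually_gt_atTop 0] with n hn hn0
    have hn' : (0 : ℝ) < n := by exact_mod_cast hn0
    have h3 : (n - m).choose (s + 2) ≤ n.choose (s + 2) :=
      Nat.choose_le_choose _ (Nat.sub_le _ _)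
    have h4 : h ≤ n.choose (s + 2) - (n - m).choose (s + 2) := by
      rw [← Nat.cast_sub h3] at hn
      exact_mod_cast hn
    rw [hE, Nat.cast_sub h4, Nat.cast_sub h3]
    field_simp
  have hDlim : Tendsto D atTop (𝓝 ((c * Real.exp (-(c / s.factorial))) ^ h)) := by
    have h1 := (tendsto_descFactorial_div_pow m).mul ((hp.pow h).mul
      (tendsto_one_sub_pow hp0 hplim hElim))
    have h2 : 1 * (c ^ h * Real.exp (-(h * (c / s.factorial)))) =
        (c * Real.exp (-(c / s.factorial))) ^ h := by
      rw [one_mul, mul_pow, ← Real.exp_nat_mul, mul_neg]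
    rw [h2] at h1
    refine h1.congr' ?_
    filter_upwards [eventually_gt_atTop 0] with n hn
    have hn' : (0 : ℝ) < n := by exact_mod_cast hn
    rw [hD, mul_pow, ← pow_mul, ← hmh]
    field_simp
  have hD0 : ∀ n, 0 ≤ (p n : ℝ) ^ h * (1 - p n) ^ E n := fun n => weight_nonneg (hp0 n) (hp1 n) _ _
  have hne : ∀ n, (powersetCard (n - m) (univ : Finset (Fin n))).Nonempty := fun n =>
    powersetCard_nonempty.2 (by simp)
  -- The summands depend on the vertex set left over by `φ`. The extremal sets of size `n - m`
  -- squeeze them, since `tendsto_uniProb_zero` gives the same limit along every sequence of such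
  -- sets; invariance under relabelling is not needed.
  choose Umin hUmin hmin using fun n =>
    exists_min_image _ (fun U : Finset (Fin n) => uniProb U s (p n) 0) (hne n)
  choose Umax hUmax hmax using fun n =>
    exists_max_image _ (fun U : Finset (Fin n) => uniProb U s (p n) 0) (hne n)
  have hcompl : ∀ n (φ : H.vertexSet ↪ Fin n),
      (univ.map φ)ᶜ ∈ powersetCard (n - m) (univ : Finset (Fin n)) := fun n φ =>
    mem_powersetCard.2 ⟨subset_univ _, by simp [card_compl, hm]⟩
  have hq : ∀ U : ∀ n, Finset (Fin n),
      (∀ n, U n ∈ powersetCard (n - m) (univ : Finset (Fin n))) →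
      Tendsto (fun n => D n * uniProb (U n) s (p n) 0 / H.aut) atTop
        (𝓝 (Real.exp (-cycleSeries (c / s.factorial)) *
          (c * Real.exp (-(c / s.factorial))) ^ h / H.aut)) := by
    intro U hU
    have hcard : ∀ n, #(U n) = n - m := fun n => (mem_powersetCard.1 (hU n)).2
    have hlim : Tendsto (fun n => uniProb (U n) s (p n) 0) atTop
        (𝓝 (Real.exp (-cycleSeries (c / s.factorial)))) := by
      refine tendsto_uniProb_zero hs hc0 hcs hp0 hp1 ?_ ?_
      · simp only [hcard]
        exact tendsto_sub_atTop_nat m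
      · simp only [hcard]
        have h1 := tendsto_choose_div_pow m 1
        simp only [Nat.choose_one_right, pow_one, Nat.factorial_one, Nat.cast_one, div_one] at h1
        have h2 := (h1.pow (s + 1)).mul hp
        rw [one_pow, one_mul] at h2
        refine h2.congr' ?_
        filter_upwards [eventually_gt_atTop 0] with n hn
        have hn' : (0 : ℝ) < n := by exact_mod_cast hn
        rw [div_pow]
        field_simp
    rw [mul_comm (Real.exp (-cycleSeries _))]
    exact (hDlim.mul hlim).div_const _
  have hformula : ∀ n, Hypergraph.probFragment (s + 2) n (p n) H =
      (∑ φ : H.vertexSet ↪ Fin n, (p n : ℝ) ^ h * (1 - p n) ^ E n *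
        uniProb (univ.map φ)ᶜ s (p n) 0) / H.aut := fun n => by
    rw [eq_div_iff haut.ne', probFragment_mul_aut hH]
  have hcardemb : ∀ n, (#(univ : Finset (H.vertexSet ↪ Fin n)) : ℝ) = n.descFactorial m :=
    fun n => by rw [card_univ, Fintype.card_embedding_eq, Fintype.card_fin]
  refine tendsto_of_tendsto_of_tendsto_of_le_of_le (hq Umin hUmin) (hq Umax hUmax)
    (fun n => ?_) (fun n => ?_)
  · simp only [hformula]
    gcongr
    rw [hD, mul_assoc, ← hcardemb, ← nsmul_eq_mul]
    exact card_nsmul_le_sum _ _ _ fun φ _ =>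
      mul_le_mul_of_nonneg_left (hmin n _ (hcompl n φ)) (hD0 n)
  · simp only [hformula]
    gcongr
    rw [hD, mul_assoc, ← hcardemb, ← nsmul_eq_mul]
    exact sum_le_card_nsmul _ _ _ fun φ _ =>
      mul_le_mul_of_nonneg_left (hmax n _ (hcompl n φ)) (hD0 n)

end Limit

end RandomHypergraph

theorem mainTheorem6 {α : Type*} (d : ℕ) (hd : 3 ≤ d) (c : ℝ) (hc : 0 < c)
    (hcd : c < ((d - 2).factorial : ℝ)) (p : ℕ → unitInterval)
    (hp : (fun n => (p n : ℝ)) ~[atTop] fun n => c / (n : ℝ) ^ (d - 1))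
    (H : Hypergraph α) (hH : H.HasUnicyclicComponents d) :
    Tendsto (fun n => Hypergraph.probFragment d n (p n) H) atTop
      (𝓝 (Real.exp (-Hypergraph.cycleSum d c)
        * (c * Real.exp (-(c / ((d - 2).factorial : ℝ)))) ^ H.size / (H.aut : ℝ))) := by
  obtain ⟨s, rfl⟩ : ∃ s, d = s + 2 := ⟨d - 2, by omega⟩
  have hlim : Tendsto (fun n : ℕ => (n : ℝ) ^ (s + 1) * (p n : ℝ)) atTop (𝓝 c) := by
    have h1 : ∀ᶠ n : ℕ in atTop, c / (n : ℝ) ^ (s + 2 - 1) ≠ 0 := by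
      filter_upwards [eventually_gt_atTop 0] with n hn
      positivity
    have h2 := ((isEquivalent_iff_tendsto_one h1).1 hp).const_mul c
    rw [mul_one] at h2
    refine h2.congr' ?_
    filter_upwards [eventually_gt_atTop 0] with n hn
    have hn' : (0 : ℝ) < n := by exact_mod_cast hn
    simp only [Pi.div_apply, show s + 2 - 1 = s + 1 by omega]
    field_simp
  -- `cycleSum (s + 2) c` unfolds to `cycleSeries (c / s.factorial)`.
  exact RandomHypergraph.tendsto_probFragment (by omega) hc hcd hlim hH
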